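/- \textbf{Setting.} Let $n$ workers have computation powers $v_i:[0,\infty)\to[0,\infty)$, $i\in[n]$, that are continuous almost everywhere, and put $V_i(t)=\int_0^t v_i(\tau)\,d\tau$, so that $V_i(t)-V_i(s)=\int_s^t v_i(\tau)\,d\tau\in[0,\infty]$ for $s\le t$. An algorithm is a sequence of maps $A^k:(\mathbb R^d)^k\to\mathbb R_{\ge 0}\times[n]\times\{0,1\}\times\mathbb R^d$, $k\ge 0$. In the time multiple oracles protocol, all workers start in the state $s_i^0=(0,0,0)$, $t^0=0$, and for $k=0,1,2,\dots$ $$(t^{k+1},i^{k+1},c^{k+1},x^k)=A^k(g^1,\dots,g^k),\qquad (s^{k+1}_{i^{k+1}},g^{k+1})=O_{i^{k+1}}(t^{k+1},x^k,s^k_{i^{k+1}},c^{k+1}),$$ with $s_j^{k+1}=s_j^k$ for $j\neq i^{k+1}$, where $$O_i(t,x,(s_t,s_x,s_q),c)=\begin{cases}((t,x,1),\,0), & c=0,\ s_q=0,\\ ((s_t,s_x,1),\,0), & c=0,\ s_q=1,\ V_i(t)-V_i(s_t)<1,\\ ((0,0,0),\,g_i(s_x;\xi,t)), & c=0,\ s_q=1,\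 V_i(t)-V_i(s_t)\ge 1,\\ ((0,0,0),\,0), & c=1,\end{cases}$$ and $\xi$ is a fresh sample, independent of the past, from a distribution $\mathcal D$. The algorithm is zero-respecting if, for all $k\geq 0$ and all $g^1,\dots,g^k\in\mathbb R^d$, $\operatorname{supp}(x^k)\subseteq\bigcup_{j=1}^k\operatorname{supp}(g^j)$, and, for all $k\ge 1$, $t^{k+1}\ge t^k$, where $x^k, t^{k+1}$ are components of $A^k(g^1,\dots,g^k)$ and $t^k$ is that of $A^{k-1}(g^1,\dots,g^{k-1})$. \textbf{Theorem.} There are universal constants $c',c_1,c_2>0$ such that the following holds. Let $L,\Delta,\varepsilon>0$ satisfy $\varepsilon<c'L\Delta$, and let the dimension $d$ be at least a number $d_0$ that depends only on $L,\Delta,\varepsilon$. Let $\sigma^2\ge 0$, and let the computation powers $v_1,\dots,v_n$ be as above. Define $\underline t_0=0$ and $$\underline t_k=\min\Big\{t\ge 0:\ \sum_{i=1}^n\big\lfloor V_i(t)-V_i(\underline t_{k-1})\big\rfloor\ \ge\ c_2\max\big\{\lceil\sigma^2/\varepsilon\rceil,1\big\}\Big\},\qquad k\ge 1,$$ with $\min\emptyset=\infty$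 (and with $\inf$ in place of $\min$ should the minimum not be attained, which can happen only if some $V_i$ is infinite at a finite time). Then for every zero-respecting algorithm $A$ in $\mathbb R^d$ there are (i) a differentiable function $f:\mathbb R^d\to\mathbb R$ with $\|\nabla f(x)-\nabla f(y)\|\le L\|x-y\|$ for all $x,y$, and $f^*\in\mathbb R$ with $f(x)\ge f^*$ for all $x$ and $f(0)-f^*\le\Delta$; (ii) a distribution $\mathcal D$ and a stochastic gradient mapping $\nabla f(x;\xi)$, the same for all workers, i.e. $g_i(x;\xi,t)=\nabla f(x;\xi)$, with $\mathbb E_{\xi\sim\mathcal D}[\nabla f(x;\xi)]=\nabla f(x)$ and $\mathbb E_{\xi\sim\mathcal D}\big[\|\nabla f(x;\xi)-\nabla f(x)\|^2\big]\le\sigma^2$ for all $x\in\mathbb R^d$; such that the sequences $x^k,t^k$ generated by the protocol satisfy $$\mathbb E\Big[\inf_{k\in S_t}\|\nabla f(x^k)\|^2\Big]>\varepsilon,\qquad S_t=\{k\in\{0,1,2,\dots\}: t^k\le t\},\qquad t=\tfrac12\,\underline t_{\lfloor c_1 L\Delta/\varepsilon\rfloor}.$$ -/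

import Mathlib

open MeasureTheory
open scoped ENNReal NNReal

noncomputable section

namespace TimeOracle

/-- The point space `ℝ^d` with its Euclidean norm. -/
abbrev Pt (d : ℕ) : Type := EuclideanSpace ℝ (Fin d)

/-! ### Universal computation model -/

/-- A computation power `v : [0, ∞) → [0, ∞)` that is continuous almost everywhere.
(Values of `v` at negative arguments play no role.) -/
structure IsComputationPower (v : ℝ → ℝ) : Prop where
  nonneg : ∀ τ, 0 ≤ τ → 0 ≤ v τ
  ae_continuous : ∀ᵐ τ ∂(volume.restrict (Set.Ici (0 : ℝ))), ContinuousWithinAt v (Set.Ici 0) τ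

/-- The computation work `∫_s^t v(τ) dτ = V(t) - V(s)` from time `s` to time `t`, for times
`s, t ∈ [0, ∞]`. It is `0` when `t ≤ s`. -/
def work (v : ℝ → ℝ) (s t : ℝ≥0∞) : ℝ≥0∞ :=
  ∫⁻ τ in {τ : ℝ | s < ENNReal.ofReal τ ∧ ENNReal.ofReal τ ≤ t}, ENNReal.ofReal (v τ)

/-- The times `t_0 = 0`, `t_{k+1} = min {t ≥ 0 : ∑ i, ⌊V_i(t) - V_i(t_k)⌋ ≥ M}`, in `[0, ∞]`,
with the convention `min ∅ = ∞`. -/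
def lowerTime {n : ℕ} (v : Fin n → ℝ → ℝ) (M : ℝ) : ℕ → ℝ≥0∞
  | 0 => 0
  | k + 1 => sInf {t : ℝ≥0∞ | ENNReal.ofReal M ≤
      ((∑ i, ENat.floor (work (v i) (lowerTime v M k) t) : ℕ∞) : ℝ≥0∞)}

/-! ### Algorithms -/

/-- What an algorithm returns in iteration `k`: the time `t^{k+1}`, the index `i^{k+1}` of the
worker it calls, the control variable `c^{k+1}` (`true` stops the computation of the worker),
and the point `x^k`. -/
structure Query (n d : ℕ) where
  time : ℝ≥0
  worker : Fin n
  cancel : Bool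
  point : Pt d

/-- An algorithm `A = {A^k}`; `A k ![g^1, …, g^k]` is the query of iteration `k`. -/
abbrev Algorithm (n d : ℕ) : Type := (k : ℕ) → (Fin k → Pt d) → Query n d

/-- Zero-respecting algorithms: the support of `x^k` lies in the union of the supports of
`g^1, …, g^k`, and the times are non-decreasing. -/
structure Algorithm.IsZeroRespecting {n d : ℕ} (A : Algorithm n d) : Prop where
  supp_subset : ∀ (k : ℕ) (g : Fin k → Pt d) (a : Fin d),
    (A k g).point a ≠ 0 → ∃ j : Fin k, g j a ≠ 0
  time_mono : ∀ (k : ℕ) (g : Fin (k + 1) → Pt d),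
    (A k (Fin.init g)).time ≤ (A (k + 1) g).time

/-! ### Oracles and the time multiple oracles protocol -/

/-- The state `(s_t, s_x, s_q)` of an oracle. -/
structure OracleState (d : ℕ) where
  time : ℝ≥0
  point : Pt d
  busy : Bool

/-- The idle state `(0, 0, 0)`. -/
def OracleState.idle (d : ℕ) : OracleState d := ⟨0, 0, false⟩

open Classical in
/-- The oracle of a worker with computation power `v` and stochastic gradient mapping
`g x ξ t`, called at time `t` in the point `x` with state `s` and control variable `c`, where `ξ`
is the fresh sample. It returns the new state and the output vector. -/
def oracle {d : ℕ} {Ξ : Type} (v : ℝ → ℝ) (g : Pt d → Ξ → ℝ≥0 → Pt d) (ξ : Ξ)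
    (t : ℝ≥0) (x : Pt d) (s : OracleState d) (c : Bool) : OracleState d × Pt d :=
  if c = true then (OracleState.idle d, 0)
  else if s.busy = false then (⟨t, x, true⟩, 0)
  else if work v s.time t < 1 then (s, 0)
  else (OracleState.idle d, g s.point ξ t)

/-- The states of all workers and the vectors `g^1, …, g^k` after `k` iterations of the protocol.
`ω k` is the random sample available in iteration `k`. -/
def run {n d : ℕ} {Ξ : Type} (v : Fin n → ℝ → ℝ) (g : Fin n → Pt d → Ξ → ℝ≥0 → Pt d)
    (A : Algorithm n d) (ω : ℕ → Ξ) : (k : ℕ) → (Fin n → OracleState d) × (Fin k → Pt d)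
  | 0 => (fun _ => OracleState.idle d, Fin.elim0)
  | k + 1 =>
    let r := run v g A ω k
    let q := A k r.2
    let o := oracle (v q.worker) (g q.worker) (ω k) q.time q.point (r.1 q.worker) q.cancel
    (Function.update r.1 q.worker o.1, Fin.snoc r.2 o.2)

/-- The point `x^k` of the protocol. -/
def iterPoint {n d : ℕ} {Ξ : Type} (v : Fin n → ℝ → ℝ) (g : Fin n → Pt d → Ξ → ℝ≥0 → Pt d)
    (A : Algorithm n d) (ω : ℕ → Ξ) (k : ℕ) : Pt d :=
  (A k (run v g A ω k).2).point

/-- The time `t^k` of the protocol; the time starts from `t^0 = 0`. -/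
def iterTime {n d : ℕ} {Ξ : Type} (v : Fin n → ℝ → ℝ) (g : Fin n → Pt d → Ξ → ℝ≥0 → Pt d)
    (A : Algorithm n d) (ω : ℕ → Ξ) : ℕ → ℝ≥0
  | 0 => 0
  | k + 1 => (A k (run v g A ω k).2).time

/-- `inf_{k ∈ S_t} ‖∇f(x^k)‖²` with `S_t = {k : t^k ≤ t}`, as a function of the samples. -/
def bestGradSq {n d : ℕ} {Ξ : Type} (v : Fin n → ℝ → ℝ) (g : Fin n → Pt d → Ξ → ℝ≥0 → Pt d)
    (A : Algorithm n d) (f : Pt d → ℝ) (t : ℝ≥0∞) (ω : ℕ → Ξ) : ℝ≥0∞ :=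
  ⨅ k ∈ {k : ℕ | (iterTime v g A ω k : ℝ≥0∞) ≤ t},
    ENNReal.ofReal (‖gradient f (iterPoint v g A ω k)‖ ^ 2)

/-! ### Functions and stochastic gradients -/

/-- `f` is differentiable and its gradient is `L`-Lipschitz. -/
def IsSmooth {d : ℕ} (L : ℝ) (f : Pt d → ℝ) : Prop :=
  Differentiable ℝ f ∧ ∀ x y, ‖gradient f x - gradient f y‖ ≤ L * ‖x - y‖

/-- The stochastic gradient mapping `G x ξ`, `ξ ∼ D`, is an unbiased estimator of `∇f(x)` with
variance at most `σ²`, for every `x`. -/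
structure IsStochasticGradient {d : ℕ} {Ξ : Type} [MeasurableSpace Ξ] (D : Measure Ξ)
    (f : Pt d → ℝ) (σ : ℝ) (G : Pt d → Ξ → Pt d) : Prop where
  integrable : ∀ x, Integrable (G x) D
  unbiased : ∀ x, ∫ ξ, G x ξ ∂D = gradient f x
  integrable_sq : ∀ x, Integrable (fun ξ => ‖G x ξ - gradient f x‖ ^ 2) D
  variance_le : ∀ x, ∫ ξ, ‖G x ξ - gradient f x‖ ^ 2 ∂D ≤ σ ^ 2

end TimeOracle

end

noncomputable section

namespace TimeOracle

/-! ### Scalar building blocks -/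

/-! The hard function is a rescaled chain of `T ≈ LΔ/(3072 ε)` coordinates. A coordinate has a
non-zero partial derivative only if it or its predecessor is non-zero, and the squared gradient norm
is at least `4ε` until the last coordinate is moved. Noise slows this down: the gradient entries in
the zero tail of `x` are replaced by `0`, except that with probability `p` they are shown divided by
`p`. Only one of them can be non-zero, so a variance `σ²` allows `p = 64/(64 + σ²/ε)`.

A zero-respecting algorithm can therefore gain a level (one more coordinate) only by a lucky coin in
a computation that was begun at the current level; an older computation returns only coordinates
already known. Such a trial costs its worker one unit of work after the level began. A level with at
least `M` trials is long, and it carries the clock past the next `lowerTime` (`lowerTime_succ_le`).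
A short level needs a success among its first `m - 1` trials, `m = ⌈M⌉`. The coin of an iteration is
independent of its being a trial, so the expected number of short levels among the first `T` is at
most `p T (m - 1) ≤ T/4` (`lintegral_shortLevels_le`).

By Markov's inequality, with probability at least `1/2` fewer than `T/2` levels are short. Then
level `T` comes after at least `K` long levels, hence not by half of `lowerTime` number `K`, and the
expectation is at least `4ε · 1/2 > ε`. The invariant that makes this precise is `Ledger.Valid`,
preserved by each iteration (`Ledger.Valid.step`). -/

theorem hasDerivAt_max_zero_sq (x : ℝ) :
    HasDerivAt (fun y : ℝ => max y 0 ^ 2) (2 * max x 0) x := by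
  rw [hasDerivAt_iff_isLittleO]
  refine Asymptotics.IsBigO.trans_isLittleO (g := fun y : ℝ => (y - x) ^ 2) ?_ ?_
  -- The first-order Taylor error lies between `0` and `(y - x)²`, also across the kink at `0`.
  · refine Asymptotics.IsBigO.of_bound 1 (Filter.Eventually.of_forall fun y => ?_)
    rw [Real.norm_eq_abs, Real.norm_eq_abs, abs_of_nonneg (sq_nonneg (y - x)), smul_eq_mul, abs_le]
    rcases max_cases y 0 with ⟨h, h'⟩ | ⟨h, h'⟩ <;> rcases max_cases x 0 with ⟨k, k'⟩ | ⟨k, k'⟩ <;>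
      rw [h, k] <;> constructor <;> nlinarith
  · have h : (fun y : ℝ => (y - x) ^ 2) = fun y => (y - x) * (y - x) := by ext; ring
    rw [h]
    have h1 : (fun y : ℝ => y - x) =o[nhds x] fun _ => (1 : ℝ) := by
      rw [Asymptotics.isLittleO_one_iff]
      have : Filter.Tendsto (fun y : ℝ => y - x) (nhds x) (nhds (x - x)) :=
        (continuous_id.sub continuous_const).tendsto x
      simpa using this
    simpa using h1.mul_isBigO (Asymptotics.isBigO_refl (fun y : ℝ => y - x) (nhds x))

/-- The activation `x₊² / (1 + x₊²)`, vanishing on `(-∞, 0]`. -/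
def act (x : ℝ) : ℝ := 1 - (1 + max x 0 ^ 2)⁻¹

/-- The derivative of `act`. -/
def act' (x : ℝ) : ℝ := 2 * max x 0 / (1 + max x 0 ^ 2) ^ 2

/-- A bounded increasing positive function. -/
def ramp (x : ℝ) : ℝ := Real.arctan x + Real.pi / 2

/-- The derivative of `ramp`. -/
def ramp' (x : ℝ) : ℝ := (1 + x ^ 2)⁻¹

/-- A penalty for negative arguments. -/
def pen (x : ℝ) : ℝ := max (-x) 0 ^ 2 / 2

/-- The derivative of `pen`. -/
def pen' (x : ℝ) : ℝ := -max (-x) 0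

theorem hasDerivAt_act (x : ℝ) : HasDerivAt act (act' x) x := by
  have h := (((hasDerivAt_max_zero_sq x).const_add 1).inv (by positivity)).const_sub 1
  exact h.congr_deriv (by simp [act', neg_div])

theorem hasDerivAt_ramp (x : ℝ) : HasDerivAt ramp (ramp' x) x := by
  have h := (Real.hasDerivAt_arctan x).add_const (Real.pi / 2)
  exact h.congr_deriv (by simp [ramp'])

theorem hasDerivAt_pen (x : ℝ) : HasDerivAt pen (pen' x) x := by
  have h := ((hasDerivAt_max_zero_sq (-x)).comp x (hasDerivAt_neg x)).div_const 2
  exact h.congr_deriv (by rw [pen']; ring)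

theorem act_nonneg (x : ℝ) : 0 ≤ act x := by
  have : (1 + max x 0 ^ 2)⁻¹ ≤ 1 := inv_le_one_of_one_le₀ (by nlinarith [sq_nonneg (max x 0)])
  unfold act; linarith

theorem act_le_one (x : ℝ) : act x ≤ 1 := by
  have : 0 ≤ (1 + max x 0 ^ 2)⁻¹ := by positivity
  unfold act; linarith

theorem half_le_act {x : ℝ} (hx : 1 ≤ x) : 1 / 2 ≤ act x := by
  have h : (1 + max x 0 ^ 2)⁻¹ ≤ 2⁻¹ := by
    apply inv_anti₀ (by norm_num)
    rw [max_eq_left (by linarith)]; nlinarith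
  unfold act; linarith

@[simp] theorem act_zero : act 0 = 0 := by simp [act]

@[simp] theorem act'_zero : act' 0 = 0 := by simp [act']

@[simp] theorem pen_zero : pen 0 = 0 := by simp [pen]

@[simp] theorem pen'_zero : pen' 0 = 0 := by simp [pen']

theorem act'_nonneg (x : ℝ) : 0 ≤ act' x := by unfold act'; positivity

theorem act'_le_one (x : ℝ) : act' x ≤ 1 := by
  unfold act'
  rw [div_le_one (by positivity)]
  nlinarith [sq_nonneg (max x 0 - 1), sq_nonneg (max x 0), sq_nonneg (max x 0 ^ 2)]

theorem ramp_nonneg (x : ℝ) : 0 ≤ ramp x := by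
  have := Real.neg_pi_div_two_lt_arctan x
  unfold ramp; linarith

theorem ramp_le_four (x : ℝ) : ramp x ≤ 4 := by
  have := Real.arctan_lt_pi_div_two x
  have := Real.pi_le_four
  unfold ramp; linarith

theorem ramp'_nonneg (x : ℝ) : 0 ≤ ramp' x := by unfold ramp'; positivity

theorem ramp'_le_one (x : ℝ) : ramp' x ≤ 1 :=
  inv_le_one_of_one_le₀ (by nlinarith [sq_nonneg x])

theorem pen_nonneg (x : ℝ) : 0 ≤ pen x := by unfold pen; positivity

theorem pen'_nonpos (x : ℝ) : pen' x ≤ 0 := by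
  unfold pen'; have := le_max_right (-x) 0; linarith

/-! ### Lipschitz bounds for the scalar functions -/

theorem abs_sub_le_of_hasDerivAt {f f' : ℝ → ℝ} {C : ℝ} (hf : ∀ x, HasDerivAt f (f' x) x)
    (hC : ∀ x, |f' x| ≤ C) (x y : ℝ) : |f x - f y| ≤ C * |x - y| :=
  convex_univ.norm_image_sub_le_of_norm_hasDerivWithin_le
    (fun z _ => (hf z).hasDerivWithinAt) (fun z _ => hC z) (Set.mem_univ y) (Set.mem_univ x)

theorem abs_act_sub_le (x y : ℝ) : |act x - act y| ≤ |x - y| := by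
  simpa using abs_sub_le_of_hasDerivAt (C := 1) hasDerivAt_act
    (fun x => by rw [abs_of_nonneg (act'_nonneg x)]; exact act'_le_one x) x y

theorem abs_ramp_sub_le (x y : ℝ) : |ramp x - ramp y| ≤ |x - y| := by
  simpa using abs_sub_le_of_hasDerivAt (C := 1) hasDerivAt_ramp
    (fun x => by rw [abs_of_nonneg (ramp'_nonneg x)]; exact ramp'_le_one x) x y

theorem abs_ramp'_sub_le (x y : ℝ) : |ramp' x - ramp' y| ≤ |x - y| := by
  have hd : ∀ x, HasDerivAt ramp' (-(2 * x) / (1 + x ^ 2) ^ 2) x := fun x => by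
    have h := (((hasDerivAt_id x).pow 2).const_add 1).inv (by simp; positivity)
    exact h.congr_deriv (by simp)
  have := abs_sub_le_of_hasDerivAt (C := 1) hd (fun x => by
    rw [abs_div, abs_of_pos (show 0 < (1 + x ^ 2) ^ 2 by positivity), div_le_one (by positivity),
      abs_le]
    constructor <;> nlinarith [sq_nonneg (x - 1), sq_nonneg (x + 1), sq_nonneg (x ^ 2)]) x y
  simpa using this

/-- `act'` has a kink at `0`, so the mean value bound is applied to the smooth `2u / (1 + u²)²` and
composed with the 1-Lipschitz map `max · 0`. -/
theorem abs_act'_sub_le (x y : ℝ) : |act' x - act' y| ≤ 2 * |x - y| := by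
  have hd : ∀ u : ℝ, HasDerivAt (fun u : ℝ => 2 * u / (1 + u ^ 2) ^ 2)
      ((2 - 6 * u ^ 2) / (1 + u ^ 2) ^ 3) u := fun u => by
    have h := ((hasDerivAt_id u).const_mul 2).div ((((hasDerivAt_id u).pow 2).const_add 1).pow 2)
      (by simp; positivity)
    refine h.congr_deriv ?_
    have : (1 + u ^ 2) ≠ 0 := by positivity
    simp
    field_simp
    ring
  have h1 := abs_sub_le_of_hasDerivAt (C := 2) hd (fun u => by
    rw [abs_div, abs_of_pos (show 0 < (1 + u ^ 2) ^ 3 by positivity), div_le_iff₀ (by positivity),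
      abs_le]
    have := sq_nonneg u
    constructor <;> nlinarith [pow_nonneg this 2, pow_nonneg this 3]) (max x 0) (max y 0)
  refine h1.trans ?_
  have := abs_max_sub_max_le_abs x y 0
  linarith

theorem abs_pen'_sub_le (x y : ℝ) : |pen' x - pen' y| ≤ |x - y| := by
  have := abs_max_sub_max_le_abs (-x) (-y) 0
  rw [neg_sub_neg, abs_sub_comm y x] at this
  rwa [pen', pen', neg_sub_neg, abs_sub_comm]

/-- The descent of a coordinate `b < 1` whose predecessor `a` is at least `1`. -/
theorem quarter_le_descent {a b : ℝ} (ha : 1 ≤ a) (hb : b < 1) :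
    1 / 4 ≤ act a * ramp' b - pen' b := by
  have h1 := half_le_act ha
  have h2 := ramp'_nonneg b
  -- For `b ≥ -1` the slope of `ramp` suffices; below that it may be tiny, and the slope of the
  -- penalty takes over.
  by_cases hb' : -1 ≤ b
  · have h3 : 1 / 2 ≤ ramp' b := by
      unfold ramp'
      rw [one_div]
      exact inv_anti₀ (by positivity) (by nlinarith)
    have := pen'_nonpos b
    nlinarith
  · have : 1 ≤ max (-b) 0 := le_max_of_le_left (by linarith)
    unfold pen'
    nlinarith

/-! ### The chain function -/

variable {d : ℕ}

/-- The coordinate functional number `j - 1` for `1 ≤ j ≤ T`, and `0` for all other `j`. -/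
def chainCoord (d T : ℕ) : ℕ → Pt d →L[ℝ] ℝ
  | 0 => 0
  | j + 1 => if h : j < d ∧ j < T then EuclideanSpace.proj ⟨j, h.1⟩ else 0

/-- The sequence `1, x_0, …, x_{T-1}, 0, 0, …`. -/
def chainSeq (T : ℕ) (x : Pt d) (j : ℕ) : ℝ := (if j = 0 then 1 else 0) + chainCoord d T j x

@[simp] theorem chainSeq_zero (T : ℕ) (x : Pt d) : chainSeq T x 0 = 1 := by
  simp [chainSeq, chainCoord]

theorem chainCoord_succ {T : ℕ} (i : Fin d) (hi : (i : ℕ) < T) (x : Pt d) :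
    chainCoord d T (i + 1) x = x i := by
  simp [chainCoord, hi]

theorem chainCoord_eq_zero {T j : ℕ} (hj : T ≤ j) : chainCoord d T (j + 1) = 0 := by
  simp only [chainCoord]
  rw [dif_neg]
  omega

theorem chainSeq_succ {T : ℕ} (i : Fin d) (hi : (i : ℕ) < T) (x : Pt d) :
    chainSeq T x (i + 1) = x i := by
  simp [chainSeq, chainCoord_succ i hi]

theorem chainSeq_succ_eq_zero {T ℓ j : ℕ} {x : Pt d} (hx : ∀ i : Fin d, ℓ ≤ i → x i = 0)
    (hj : ℓ ≤ j) : chainSeq T x (j + 1) = 0 := by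
  by_cases h : j < d ∧ j < T
  · rw [chainSeq_succ ⟨j, h.1⟩ h.2]
    exact hx _ hj
  · simp [chainSeq, chainCoord, h]

theorem chainSeq_sub (T : ℕ) (x y : Pt d) (j : ℕ) :
    chainSeq T x j - chainSeq T y j = chainCoord d T j (x - y) := by
  simp [chainSeq]

/-- The hard function: a chain of `T` coordinates in which each has to be moved before the next one
has a non-zero partial derivative. -/
def chain (T : ℕ) (x : Pt d) : ℝ :=
  ∑ j ∈ Finset.range (T + 1),
    (pen (chainSeq T x (j + 1)) - act (chainSeq T x j) * ramp (chainSeq T x (j + 1)))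

/-- The partial derivative of `chain` in the coordinate number `i < T`. -/
def chainPartial (T : ℕ) (x : Pt d) (i : ℕ) : ℝ :=
  pen' (chainSeq T x (i + 1)) - act (chainSeq T x i) * ramp' (chainSeq T x (i + 1)) -
    act' (chainSeq T x (i + 1)) * ramp (chainSeq T x (i + 2))

/-- The gradient of `chain`. -/
def chainGrad (T : ℕ) (x : Pt d) : Pt d :=
  WithLp.toLp 2 fun i => if (i : ℕ) < T then chainPartial T x i else 0

theorem chainGrad_apply (T : ℕ) (x : Pt d) (i : Fin d) :
    chainGrad T x i = if (i : ℕ) < T then chainPartial T x i else 0 := rfl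

theorem hasFDerivAt_chainSeq (T : ℕ) (x : Pt d) (j : ℕ) :
    HasFDerivAt (fun x => chainSeq T x j) (chainCoord d T j) x :=
  (chainCoord d T j).hasFDerivAt.const_add _

/-- Summand `j` contributes to coordinates `j + 1` and `j` of the sequence. Collecting by coordinate
is an index shift whose boundary terms vanish, because entry `0` is the constant `1` and entry `T +
1` is the constant `0`. -/
theorem hasGradientAt_chain {T : ℕ} (hT : T ≤ d) (x : Pt d) :
    HasGradientAt (chain T) (chainGrad T x) x := by
  rw [hasGradientAt_iff_hasFDerivAt]
  have h : HasFDerivAt (chain T) (∑ j ∈ Finset.range (T + 1),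
      (pen' (chainSeq T x (j + 1)) • chainCoord d T (j + 1) -
        (act (chainSeq T x j) • ramp' (chainSeq T x (j + 1)) • chainCoord d T (j + 1) +
        ramp (chainSeq T x (j + 1)) • act' (chainSeq T x j) • chainCoord d T j))) x := by
    refine HasFDerivAt.fun_sum fun j _ => ?_
    exact ((hasDerivAt_pen _).comp_hasFDerivAt x (hasFDerivAt_chainSeq T x (j + 1))).sub
      (((hasDerivAt_act _).comp_hasFDerivAt x (hasFDerivAt_chainSeq T x j)).mul
      ((hasDerivAt_ramp _).comp_hasFDerivAt x (hasFDerivAt_chainSeq T x (j + 1))))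
  refine h.congr_fderiv (ContinuousLinearMap.ext fun y => Eq.symm ?_)
  have h1 : (InnerProductSpace.toDual ℝ (Pt d) (chainGrad T x)) y =
      ∑ j ∈ Finset.range T, chainPartial T x j * chainCoord d T (j + 1) y := by
    rw [InnerProductSpace.toDual_apply_apply, PiLp.inner_apply]
    have h2 : ∀ i : Fin d, inner ℝ (chainGrad T x i) (y i) =
        (fun j : ℕ => chainPartial T x j * chainCoord d T (j + 1) y) i := by
      intro i
      rw [chainGrad_apply]
      by_cases hi : (i : ℕ) < T
      · simp [hi, chainCoord_succ i hi, mul_comm]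
      · simp [hi, chainCoord_eq_zero (d := d) (not_lt.1 hi)]
    rw [Finset.sum_congr rfl fun i _ => h2 i, Fin.sum_univ_eq_sum_range
      (fun j : ℕ => chainPartial T x j * chainCoord d T (j + 1) y)]
    symm
    refine Finset.sum_subset (Finset.range_subset_range.2 hT) fun j _ hj => ?_
    rw [Finset.mem_range, not_lt] at hj
    simp [chainCoord_eq_zero (d := d) hj]
  rw [h1]
  simp only [sum_apply, sub_apply, smul_apply, smul_eq_mul, ← sub_sub]
  rw [Finset.sum_sub_distrib, Finset.sum_range_succ, Finset.sum_range_succ']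
  rw [chainCoord_eq_zero (d := d) le_rfl]
  simp only [chainCoord, zero_apply, mul_zero, sub_zero, add_zero]
  rw [← Finset.sum_sub_distrib]
  refine Finset.sum_congr rfl fun j _ => ?_
  rw [chainPartial]
  ring

theorem abs_mul_sub_mul_le {a b a' b' A B u w : ℝ} (ha : |a| ≤ A) (hb : |b'| ≤ B)
    (hu : |a - a'| ≤ u) (hw : |b - b'| ≤ w) : |a * b - a' * b'| ≤ A * w + B * u := by
  have : a * b - a' * b' = a * (b - b') + b' * (a - a') := by ring
  rw [this]
  refine (abs_add_le _ _).trans ?_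
  rw [abs_mul, abs_mul]
  exact add_le_add
    (mul_le_mul ha hw (abs_nonneg _) ((abs_nonneg _).trans ha))
    (mul_le_mul hb hu (abs_nonneg _) ((abs_nonneg _).trans hb))

/-- The weight `10` is `1` from `pen'`, `1` from `ramp'` and `4 · 2` from `act'` times the bound of
`ramp`. -/
theorem abs_chainPartial_sub_le (T : ℕ) (x y : Pt d) (i : ℕ) :
    |chainPartial T x i - chainPartial T y i| ≤
      |chainSeq T x i - chainSeq T y i| + 10 * |chainSeq T x (i + 1) - chainSeq T y (i + 1)| +
        |chainSeq T x (i + 2) - chainSeq T y (i + 2)| := by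
  unfold chainPartial
  generalize chainSeq T x i = a
  generalize chainSeq T y i = a'
  generalize chainSeq T x (i + 1) = b
  generalize chainSeq T y (i + 1) = b'
  generalize chainSeq T x (i + 2) = c
  generalize chainSeq T y (i + 2) = c'
  have h1 := abs_pen'_sub_le b b'
  have h2 := abs_mul_sub_mul_le (a := act a) (A := 1) (B := 1) (b' := ramp' b')
    (by rw [abs_of_nonneg (act_nonneg a)]; exact act_le_one a)
    (by rw [abs_of_nonneg (ramp'_nonneg b')]; exact ramp'_le_one b')
    (abs_act_sub_le a a') (abs_ramp'_sub_le b b')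
  have h3 := abs_mul_sub_mul_le (a := act' b) (A := 1) (B := 4) (b' := ramp c')
    (by rw [abs_of_nonneg (act'_nonneg b)]; exact act'_le_one b)
    (by rw [abs_of_nonneg (ramp_nonneg c')]; exact ramp_le_four c')
    (abs_act'_sub_le b b') (abs_ramp_sub_le c c')
  rw [abs_le] at h1 h2 h3 ⊢
  constructor <;> linarith

theorem norm_chainGrad_sub_le (T : ℕ) (x y : Pt d) :
    ‖chainGrad T x - chainGrad T y‖ ≤ 12 * ‖x - y‖ := by
  set u : ℕ → ℝ := fun j => |chainSeq T x j - chainSeq T y j| with hu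
  have hu0 : u 0 = 0 := by simp [hu]
  have hud : u (d + 1) = 0 := by simp [hu, chainSeq, chainCoord]
  have hS : ∑ j ∈ Finset.range d, u (j + 1) ^ 2 ≤ ‖x - y‖ ^ 2 := by
    rw [EuclideanSpace.norm_sq_eq, ← Fin.sum_univ_eq_sum_range (fun j => u (j + 1) ^ 2)]
    refine Finset.sum_le_sum fun i _ => ?_
    simp only [hu, chainSeq_sub]
    by_cases hi : (i : ℕ) < T
    · rw [chainCoord_succ i hi, Real.norm_eq_abs]
    · rw [chainCoord_eq_zero (not_lt.1 hi)]
      simp only [zero_apply, abs_zero, zero_pow two_ne_zero]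
      positivity
  have hS0 : ∑ j ∈ Finset.range d, u j ^ 2 ≤ ∑ j ∈ Finset.range d, u (j + 1) ^ 2 := by
    have h1 := Finset.sum_range_succ (fun j => u j ^ 2) d
    have h2 := Finset.sum_range_succ' (fun j => u j ^ 2) d
    have := sq_nonneg (u d)
    rw [hu0] at h2
    linarith
  have hS2 : ∑ j ∈ Finset.range d, u (j + 2) ^ 2 ≤ ∑ j ∈ Finset.range d, u (j + 1) ^ 2 := by
    have h1 := Finset.sum_range_succ (fun j => u (j + 1) ^ 2) d
    have h2 := Finset.sum_range_succ' (fun j => u (j + 1) ^ 2) d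
    have := sq_nonneg (u (0 + 1))
    rw [hud] at h1
    linarith
  have key : ‖chainGrad T x - chainGrad T y‖ ^ 2 ≤
      ∑ j ∈ Finset.range d, (12 * u j ^ 2 + 120 * u (j + 1) ^ 2 + 12 * u (j + 2) ^ 2) := by
    rw [EuclideanSpace.norm_sq_eq, ← Fin.sum_univ_eq_sum_range
      (fun j => 12 * u j ^ 2 + 120 * u (j + 1) ^ 2 + 12 * u (j + 2) ^ 2)]
    refine Finset.sum_le_sum fun i _ => ?_
    rw [PiLp.sub_apply, chainGrad_apply, chainGrad_apply]
    split_ifs with hi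
    · have h := abs_chainPartial_sub_le T x y i
      change _ ≤ u i + 10 * u (i + 1) + u (i + 2) at h
      rw [Real.norm_eq_abs]
      refine (pow_le_pow_left₀ (abs_nonneg _) h 2).trans ?_
      -- Cauchy–Schwarz with weights `1, 10, 1`: `(a + 10b + c)² ≤ 12 (a² + 10b² + c²)`. Summing the
      -- three shifts gives `12 + 120 + 12 = 12²`.
      nlinarith [sq_nonneg (u i - u (i + 1)), sq_nonneg (u i - u (i + 2)),
        sq_nonneg (u (i + 2) - u (i + 1))]
    · simp only [sub_zero, norm_zero, zero_pow two_ne_zero]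
      positivity
  rw [Finset.sum_add_distrib, Finset.sum_add_distrib, ← Finset.mul_sum, ← Finset.mul_sum,
    ← Finset.mul_sum] at key
  refine abs_le_of_sq_le_sq' (b := 12 * ‖x - y‖) ?_ (by positivity) |>.2
  rw [mul_pow]
  linarith

theorem neg_le_chain (T : ℕ) (x : Pt d) : -(4 * ((T : ℝ) + 1)) ≤ chain T x := by
  have h : ∑ j ∈ Finset.range (T + 1), (-4 : ℝ) ≤ chain T x := by
    refine Finset.sum_le_sum fun j _ => ?_
    have h1 := pen_nonneg (chainSeq T x (j + 1))
    have h2 := mul_le_mul (act_le_one (chainSeq T x j)) (ramp_le_four (chainSeq T x (j + 1)))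
      (ramp_nonneg _) zero_le_one
    linarith
  simp only [Finset.sum_const, Finset.card_range, nsmul_eq_mul, Nat.cast_add, Nat.cast_one] at h
  linarith

theorem chain_zero_nonpos (T : ℕ) : chain T (0 : Pt d) ≤ 0 := by
  refine Finset.sum_nonpos fun j _ => ?_
  rw [chainSeq_succ_eq_zero (ℓ := 0) (fun _ _ => rfl) (Nat.zero_le j), pen_zero]
  have := mul_nonneg (act_nonneg (chainSeq T (0 : Pt d) j)) (ramp_nonneg 0)
  linarith

/-- As long as the last coordinate of the chain is zero, the gradient is bounded away from zero. -/
theorem quarter_le_norm_chainGrad {T : ℕ} (hT : T ≤ d) (x : Pt d) (hx : chainSeq T x T < 1) :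
    1 / 4 ≤ ‖chainGrad T x‖ := by
  classical
  have hex : ∃ j, chainSeq T x j < 1 := ⟨T, hx⟩
  obtain ⟨i, hi⟩ : ∃ i, Nat.find hex = i + 1 := by
    refine Nat.exists_eq_succ_of_ne_zero fun h => ?_
    have := Nat.find_spec hex
    rw [h, chainSeq_zero] at this
    exact lt_irrefl _ this
  have h1 : chainSeq T x (i + 1) < 1 := hi ▸ Nat.find_spec hex
  have h0 : 1 ≤ chainSeq T x i := not_lt.1 (Nat.find_min hex (by omega))
  have hiT : i < T := by
    have := Nat.find_min' hex hx
    omega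
  -- At the first entry below `1` all three terms of the partial derivative are nonpositive, so
  -- nothing cancels the descent.
  have h2 := quarter_le_descent h0 h1
  have h3 := mul_nonneg (act'_nonneg (chainSeq T x (i + 1))) (ramp_nonneg (chainSeq T x (i + 2)))
  have h4 := PiLp.norm_apply_le (chainGrad T x) ⟨i, hiT.trans_le hT⟩
  rw [chainGrad_apply, if_pos hiT, Real.norm_eq_abs] at h4
  refine le_trans ?_ h4
  refine le_trans ?_ (neg_le_abs _)
  simp only [chainPartial]
  linarith

/-- Beyond the frontier both the coordinate and its predecessor vanish, and `act`, `act'` and `pen'`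
are zero at `0`. -/
theorem chainGrad_eq_zero {T ℓ : ℕ} {x : Pt d} (hx : ∀ i : Fin d, ℓ ≤ i → x i = 0)
    (i : Fin d) (hi : ℓ < i) : chainGrad T x i = 0 := by
  obtain ⟨j, hj⟩ : ∃ j, (i : ℕ) = j + 1 := Nat.exists_eq_succ_of_ne_zero (by omega)
  rw [chainGrad_apply, chainPartial, chainSeq_succ_eq_zero hx hi.le, hj,
    chainSeq_succ_eq_zero hx (by omega)]
  simp

theorem abs_chainGrad_le_one {T ℓ : ℕ} {x : Pt d} (hx : ∀ i : Fin d, ℓ ≤ i → x i = 0)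
    (i : Fin d) (hi : ℓ ≤ i) : |chainGrad T x i| ≤ 1 := by
  rw [chainGrad_apply, chainPartial, chainSeq_succ_eq_zero hx hi]
  split_ifs
  · simp only [pen'_zero, act'_zero, zero_mul, sub_zero, zero_sub, abs_neg]
    rw [abs_of_nonneg (mul_nonneg (act_nonneg _) (ramp'_nonneg _))]
    exact mul_le_one₀ (act_le_one _) (ramp'_nonneg _) (ramp'_le_one _)
  · simp

/-! ### The hard function at the scale of the problem -/

theorem hasGradientAt_scale {F : Pt d → ℝ} {F' : Pt d → Pt d} (hF : ∀ x, HasGradientAt F (F' x) x)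
    (a b : ℝ) (x : Pt d) :
    HasGradientAt (fun x => a * F (b • x)) ((a * b) • F' (b • x)) x := by
  have hb : HasFDerivAt (fun x : Pt d => b • x) (b • ContinuousLinearMap.id ℝ (Pt d)) x :=
    (hasFDerivAt_id x).const_smul b
  rw [hasGradientAt_iff_hasFDerivAt]
  have h := (((hF (b • x)).hasFDerivAt).comp x hb).const_mul a
  refine h.congr_fderiv (ContinuousLinearMap.ext fun y => ?_)
  simp [mul_assoc]

theorem exists_hard_function {L Δ ε : ℝ} (hL : 0 < L) (hε : 0 < ε) {T : ℕ} (hT : 1 ≤ T)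
    (hTd : T ≤ d) (hΔ : 3072 * ε * ((T : ℝ) + 1) ≤ L * Δ) :
    ∃ (f : Pt d → ℝ) (f' : Pt d → Pt d), (∀ x, HasGradientAt f (f' x) x) ∧
      (∀ x y, ‖f' x - f' y‖ ≤ L * ‖x - y‖) ∧
      (∃ m, (∀ x, m ≤ f x) ∧ f 0 - m ≤ Δ) ∧
      (∀ x, (∀ i : Fin d, T ≤ i + 1 → x i = 0) → 4 * ε ≤ ‖f' x‖ ^ 2) ∧
      (∀ (x : Pt d) (ℓ : ℕ), (∀ i : Fin d, ℓ ≤ i → x i = 0) →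
        (∀ i : Fin d, ℓ < i → f' x i = 0) ∧ ∀ i : Fin d, ℓ ≤ i → f' x i ^ 2 ≤ 64 * ε) := by
  obtain ⟨s, hs, rfl⟩ : ∃ s : ℝ, 0 < s ∧ s ^ 2 = ε := ⟨√ε, Real.sqrt_pos.2 hε, Real.sq_sqrt hε.le⟩
  -- The scales solve `a * b = 8s`, which turns the gradient bound `1/4` into `2s`, and `12 * a * b
  -- * b = L`. The frontier entry is then at most `8s`, whence `64ε`.
  set b : ℝ := L / (96 * s) with hb
  set a : ℝ := 768 * s ^ 2 / L with ha
  have hb0 : 0 < b := by positivity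
  have ha0 : 0 < a := by positivity
  have hab : a * b = 8 * s := by rw [ha, hb]; field_simp; norm_num
  have habb : 8 * s * 12 * b = L := by rw [hb]; field_simp; norm_num
  have hsupp : ∀ {x : Pt d} {ℓ : ℕ}, (∀ i : Fin d, ℓ ≤ i → x i = 0) →
      ∀ i : Fin d, ℓ ≤ i → (b • x) i = 0 := fun hx i hi => by simp [hx i hi]
  refine ⟨fun x => a * chain T (b • x), fun x => (a * b) • chainGrad T (b • x),
    hasGradientAt_scale (hasGradientAt_chain hTd) a b, fun x y => ?_,
    ⟨-(a * (4 * ((T : ℝ) + 1))), fun x => ?_, ?_⟩, fun x hx => ?_, fun x ℓ hx =>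
    ⟨fun i hi => ?_, fun i hi => ?_⟩⟩
  · rw [← smul_sub, norm_smul, hab, Real.norm_of_nonneg (by positivity)]
    have h := norm_chainGrad_sub_le T (b • x) (b • y)
    rw [← smul_sub, norm_smul, Real.norm_of_nonneg hb0.le] at h
    calc 8 * s * ‖chainGrad T (b • x) - chainGrad T (b • y)‖
        ≤ 8 * s * (12 * (b * ‖x - y‖)) := by gcongr
      _ = 8 * s * 12 * b * ‖x - y‖ := by ring
      _ = L * ‖x - y‖ := by rw [habb]
  · have := mul_le_mul_of_nonneg_left (neg_le_chain T (b • x)) ha0.le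
    linarith
  · have h1 := mul_le_mul_of_nonneg_left (chain_zero_nonpos (d := d) T) ha0.le
    have h2 : a * (4 * ((T : ℝ) + 1)) ≤ Δ := by
      rw [ha, div_mul_eq_mul_div, div_le_iff₀ hL]
      linarith
    simp only [smul_zero]
    linarith
  · have h1 : chainSeq T (b • x) T = 0 := by
      obtain ⟨j, rfl⟩ := Nat.exists_eq_add_of_le' hT
      exact chainSeq_succ_eq_zero (ℓ := j)
        (hsupp fun i hi => hx i (by omega)) le_rfl
    have h2 := quarter_le_norm_chainGrad hTd (b • x) (by rw [h1]; norm_num)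
    rw [norm_smul, hab, Real.norm_of_nonneg (by positivity), mul_pow]
    nlinarith [sq_nonneg s, pow_le_pow_left₀ (by norm_num) h2 2]
  · simp [chainGrad_eq_zero (hsupp hx) i hi]
  · have h1 := abs_chainGrad_le_one (T := T) (hsupp hx) i hi
    rw [PiLp.smul_apply, hab, smul_eq_mul, mul_pow]
    have h2 : chainGrad T (b • x) i ^ 2 ≤ 1 := (sq_le_one_iff_abs_le_one _).2 h1
    nlinarith [sq_nonneg s]

/-! ### Bernoulli noise on the frontier coordinate -/

/-- The law of a coin that shows `true` with probability `p`. -/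
def coin (p : ℝ) : Measure Bool :=
  ENNReal.ofReal p • Measure.dirac true + ENNReal.ofReal (1 - p) • Measure.dirac false

theorem isProbabilityMeasure_coin {p : ℝ} (h0 : 0 ≤ p) (h1 : p ≤ 1) :
    IsProbabilityMeasure (coin p) := ⟨by
  simp only [coin, Measure.add_apply, Measure.smul_apply, measure_univ, smul_eq_mul, mul_one]
  rw [← ENNReal.ofReal_add h0 (by linarith)]
  simp⟩

theorem coin_true (p : ℝ) : coin p {true} = ENNReal.ofReal p := by
  simp [coin]

theorem integral_coin {E : Type*} [NormedAddCommGroup E] [NormedSpace ℝ E] [CompleteSpace E]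
    {p : ℝ} (h0 : 0 ≤ p) (h1 : p ≤ 1) (h : Bool → E) :
    ∫ ξ, h ξ ∂(coin p) = p • h true + (1 - p) • h false := by
  rw [coin, integral_add_measure, integral_smul_measure, integral_smul_measure, integral_dirac,
    integral_dirac, ENNReal.toReal_ofReal h0, ENNReal.toReal_ofReal (by linarith)]
  · exact Integrable.smul_measure (integrable_dirac (by simp)) ENNReal.ofReal_ne_top
  · exact Integrable.smul_measure (integrable_dirac (by simp)) ENNReal.ofReal_ne_top

open Classical in
/-- The vector field `g` in which the coordinates beyond the last non-zero coordinate of `x` are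
revealed only with probability `p`, in an unbiased way. -/
def noisy (g : Pt d → Pt d) (p : ℝ) (x : Pt d) (ξ : Bool) : Pt d :=
  WithLp.toLp 2 fun i => if ∀ j, i ≤ j → x j = 0 then (if ξ = true then g x i / p else 0) else g x i

theorem noisy_apply_eq_zero {g : Pt d → Pt d} (p : ℝ) {x : Pt d} (ξ : Bool) {i : Fin d}
    (h : g x i = 0) : noisy g p x ξ i = 0 := by
  simp [noisy, h]

theorem noisy_false_apply_eq_zero (g : Pt d → Pt d) (p : ℝ) {x : Pt d} {i : Fin d}
    (hx : ∀ j, i ≤ j → x j = 0) : noisy g p x false i = 0 := by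
  simp only [noisy]
  rw [if_pos hx]
  simp

/-- Noise acts only where `x` has a zero tail, and there at most the frontier entry of the gradient
is non-zero. The variance is thus that entry squared times `p (1/p - 1)² + (1 - p) = (1 - p)/p`. -/
theorem isStochasticGradient_noisy {f : Pt d → ℝ} {f' : Pt d → Pt d}
    (hf : ∀ x, HasGradientAt f (f' x) x) {C σ p : ℝ} (hp0 : 0 < p) (hp1 : p ≤ 1)
    (hC : C * ((1 - p) / p) ≤ σ ^ 2) (hC0 : 0 ≤ C)
    (hchain : ∀ (x : Pt d) (ℓ : ℕ), (∀ i : Fin d, ℓ ≤ i → x i = 0) →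
        (∀ i : Fin d, ℓ < i → f' x i = 0) ∧ ∀ i : Fin d, ℓ ≤ i → f' x i ^ 2 ≤ C) :
    IsStochasticGradient (coin p) f σ (noisy f' p) := by
  have := isProbabilityMeasure_coin hp0.le hp1
  refine ⟨fun x => .of_finite, fun x => ?_, fun x => .of_finite, fun x => ?_⟩
  · rw [integral_coin hp0.le hp1, (hf x).gradient]
    ext i
    by_cases h : ∀ j, i ≤ j → x j = 0
    · simp only [noisy, PiLp.add_apply, PiLp.smul_apply, smul_eq_mul, if_pos h]
      simp [mul_div_cancel₀, hp0.ne']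
    · simp only [noisy, PiLp.add_apply, PiLp.smul_apply, smul_eq_mul, if_neg h]
      ring
  · rw [integral_coin hp0.le hp1, (hf x).gradient]
    classical
    set S : ℝ := ∑ i : Fin d, if ∀ j, i ≤ j → x j = 0 then f' x i ^ 2 else 0 with hS
    have hSC : S ≤ C := by
      by_cases hex : ∃ i : Fin d, ∀ j, i ≤ j → x j = 0
      -- The start of the zero tail is the frontier; all later entries of the gradient vanish.
      · obtain ⟨i, hi⟩ : ∃ i : Fin d, Minimal (fun i : Fin d => ∀ j, i ≤ j → x j = 0) i :=
          (Set.toFinite {i : Fin d | ∀ j, i ≤ j → x j = 0}).exists_minimal hex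
        have hx : ∀ j : Fin d, (i : ℕ) ≤ j → x j = 0 := fun j hj => hi.prop j hj
        rw [hS, Finset.sum_eq_single i]
        · rw [if_pos hi.prop]
          exact (hchain x i hx).2 i le_rfl
        · intro k _ hk
          split_ifs with h
          · rcases lt_or_gt_of_ne hk with hlt | hgt
            · exact absurd (hi.le_of_le h hlt.le) (not_le.2 hlt)
            · rw [(hchain x i hx).1 k hgt]
              simp
          · rfl
        · simp
      · rw [hS, Finset.sum_eq_zero]
        · exact hC0
        · intro i _
          rw [if_neg fun h => hex ⟨i, h⟩]
    have h1 : ‖noisy f' p x true - f' x‖ ^ 2 = (1 / p - 1) ^ 2 * S := by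
      rw [EuclideanSpace.norm_sq_eq, hS, Finset.mul_sum]
      refine Finset.sum_congr rfl fun i _ => ?_
      rw [Real.norm_eq_abs, sq_abs, PiLp.sub_apply]
      simp only [noisy]
      split_ifs
      · simp; ring
      · simp
    have h2 : ‖noisy f' p x false - f' x‖ ^ 2 = S := by
      rw [EuclideanSpace.norm_sq_eq, hS]
      refine Finset.sum_congr rfl fun i _ => ?_
      rw [Real.norm_eq_abs, sq_abs, PiLp.sub_apply]
      simp only [noisy, Bool.false_eq_true, if_false]
      split_ifs <;> simp
    rw [h1, h2, smul_eq_mul, smul_eq_mul]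
    refine le_trans (le_of_eq ?_) ((mul_le_mul_of_nonneg_right hSC
      (div_nonneg (by linarith) hp0.le : 0 ≤ (1 - p) / p)).trans hC)
    field_simp
    ring

variable {n : ℕ}

/-! ### Computation work and the lower time sequence -/

theorem work_mono_right (v : ℝ → ℝ) (s : ℝ≥0∞) {t t' : ℝ≥0∞} (h : t ≤ t') :
    work v s t ≤ work v s t' :=
  lintegral_mono_set fun _ hτ => ⟨hτ.1, hτ.2.trans h⟩

theorem work_anti_left (v : ℝ → ℝ) {s s' : ℝ≥0∞} (t : ℝ≥0∞) (h : s ≤ s') :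
    work v s' t ≤ work v s t :=
  lintegral_mono_set fun _ hτ => ⟨h.trans_lt hτ.1, hτ.2⟩

theorem work_eq_zero (v : ℝ → ℝ) {s t : ℝ≥0∞} (h : t ≤ s) : work v s t = 0 := by
  have : {τ : ℝ | s < ENNReal.ofReal τ ∧ ENNReal.ofReal τ ≤ t} = ∅ :=
    Set.eq_empty_of_forall_notMem fun τ hτ => absurd (hτ.1.trans_le (hτ.2.trans h)) (lt_irrefl _)
  rw [work, this]
  simp

theorem work_add_le (v : ℝ → ℝ) {r s t : ℝ≥0∞} (hrs : r ≤ s) (hst : s ≤ t) :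
    work v r s + work v s t ≤ work v r t := by
  have hm : MeasurableSet {τ : ℝ | s < ENNReal.ofReal τ ∧ ENNReal.ofReal τ ≤ t} :=
    (measurableSet_lt measurable_const ENNReal.measurable_ofReal).inter
      (measurableSet_le ENNReal.measurable_ofReal measurable_const)
  rw [work, work, ← lintegral_union hm]
  · refine lintegral_mono_set ?_
    rintro τ (h | h)
    · exact ⟨h.1, h.2.trans hst⟩
    · exact ⟨hrs.trans_lt h.1, h.2⟩
  · rw [Set.disjoint_left]
    exact fun τ h h' => absurd (h'.1.trans_le h.2) (lt_irrefl _)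

/-- No work is done between a time and an earlier one, so a target `M > 0` cannot be met before the
preceding `lowerTime`. -/
theorem lowerTime_mono (v : Fin n → ℝ → ℝ) {M : ℝ} (hM : 0 < M) : Monotone (lowerTime v M) := by
  refine monotone_nat_of_le_succ fun k => ?_
  refine le_sInf fun t ht => ?_
  by_contra! hlt
  have h0 : ∑ i, ENat.floor (work (v i) (lowerTime v M k) t) = 0 :=
    Finset.sum_eq_zero fun i _ => by rw [work_eq_zero _ hlt.le, ENat.floor_zero]
  rw [Set.mem_ofPred_eq, h0] at ht
  simp only [ENat.toENNReal_zero, nonpos_iff_eq_zero, ENNReal.ofReal_eq_zero] at ht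
  linarith

/-- Integer counts below the work pass under the floors, and measuring the work from the earlier
time `lowerTime v M k` instead of `s` only increases it. -/
theorem lowerTime_succ_le {v : Fin n → ℝ → ℝ} {M : ℝ} {k m : ℕ} {s t : ℝ≥0∞} {c : Fin n → ℕ}
    (hm : M ≤ m) (hs : lowerTime v M k ≤ s) (hc : ∀ i, (c i : ℝ≥0∞) ≤ work (v i) s t)
    (hmc : m ≤ ∑ i, c i) : lowerTime v M (k + 1) ≤ t := by
  refine sInf_le ?_
  rw [Set.mem_ofPred_eq]
  calc ENNReal.ofReal M ≤ ENNReal.ofReal m := ENNReal.ofReal_le_ofReal hm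
    _ = (((m : ℕ) : ℕ∞) : ℝ≥0∞) := by simp
    _ ≤ _ := by
        rw [ENat.toENNReal_le]
        calc ((m : ℕ) : ℕ∞) ≤ ((∑ i, c i : ℕ) : ℕ∞) := by exact_mod_cast hmc
          _ = ∑ i, (c i : ℕ∞) := by push_cast; rfl
          _ ≤ _ := Finset.sum_le_sum fun i _ => ENat.le_floor.2 <| by
            simpa using (hc i).trans (work_anti_left _ _ hs)

/-! ### The ledger of a run -/

/-- The coordinates of `x` with index at least `ℓ` vanish. -/
def SuppLT (ℓ : ℕ) (x : Pt d) : Prop := ∀ i : Fin d, ℓ ≤ i → x i = 0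

theorem SuppLT.mono {ℓ ℓ' : ℕ} {x : Pt d} (h : SuppLT ℓ x) (hℓ : ℓ ≤ ℓ') : SuppLT ℓ' x :=
  fun i hi => h i (hℓ.trans hi)

theorem SuppLT.zero (ℓ : ℕ) : SuppLT ℓ (0 : Pt d) := fun _ _ => rfl

/-- Bookkeeping along a run. A *trial* is a completed computation that was begun at the current
level; a successful trial starts the next level. -/
structure Ledger (n : ℕ) where
  /-- A bound for the number of coordinates revealed so far. -/
  level : ℕ
  /-- The time at which the current level was reached. -/
  start : ℝ≥0
  /-- The number of former levels with many trials. -/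
  long : ℕ
  /-- The level at which the current computation of a worker was begun. -/
  stamp : Fin n → ℕ
  /-- The number of failed trials of a worker in the current level. -/
  count : Fin n → ℕ

/-- The number of failed trials in the current level. -/
def Ledger.trials (l : Ledger n) : ℕ := ∑ i, l.count i

/-- The ledger before the first iteration. -/
def Ledger.empty (n : ℕ) : Ledger n := ⟨0, 0, 0, 0, 0⟩

/-- The query completes a computation that was begun at the current level. -/
def IsTrial (v : Fin n → ℝ → ℝ) (S : Fin n → OracleState d) (l : Ledger n) (q : Query n d) : Prop :=
  q.cancel = false ∧ (S q.worker).busy = true ∧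
    1 ≤ work (v q.worker) (S q.worker).time q.time ∧ l.stamp q.worker = l.level

open Classical in
/-- The ledger after a query, where a level with at least `m` trials is called long. -/
def Ledger.step (v : Fin n → ℝ → ℝ) (m : ℕ) (S : Fin n → OracleState d) (l : Ledger n)
    (q : Query n d) (ξ : Bool) : Ledger n :=
  if IsTrial v S l q then
    if ξ = true then
      ⟨l.level + 1, q.time, if m ≤ l.trials + 1 then l.long + 1 else l.long, l.stamp, 0⟩
    else { l with count := Function.update l.count q.worker (l.count q.worker + 1) }
  else if q.cancel = false ∧ (S q.worker).busy = false then
    { l with stamp := Function.update l.stamp q.worker l.level }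
  else l

theorem Ledger.sum_update_count (l : Ledger n) (w : Fin n) :
    ∑ i, Function.update l.count w (l.count w + 1) i = l.trials + 1 := by
  rw [Finset.sum_update_of_mem (Finset.mem_univ w), Ledger.trials,
    ← Finset.add_sum_erase _ _ (Finset.mem_univ w), Finset.sdiff_singleton_eq_erase]
  ring

/-- The ledger describes correctly the states `S` of the workers at time `now`. -/
structure Ledger.Valid (v : Fin n → ℝ → ℝ) (M : ℝ) (S : Fin n → OracleState d) (now : ℝ≥0)
    (l : Ledger n) : Prop where
  stamp_le : ∀ i, l.stamp i ≤ l.level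
  suppLT : ∀ i, (S i).busy = true → SuppLT (l.stamp i) (S i).point
  start_le : l.start ≤ now
  lowerTime_le : lowerTime v M l.long ≤ l.start
  -- Needed at the end, where halving a time is a strict decrease only if the time is non-zero.
  start_pos : 0 < l.level → 0 < l.start
  count_le : ∀ i, (l.count i : ℝ≥0∞) ≤ work (v i) l.start now
  time_le : ∀ i, (S i).busy = true → (S i).time ≤ now
  start_le_time : ∀ i, (S i).busy = true → l.stamp i = l.level → l.start ≤ (S i).time
  -- The trials already counted for a worker fit before its current computation, so the work of the
  -- latter comes on top.
  count_le_time : ∀ i, (S i).busy = true → l.stamp i = l.level →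
    (l.count i : ℝ≥0∞) ≤ work (v i) l.start (S i).time

section Valid

variable {v : Fin n → ℝ → ℝ} {M : ℝ} {S : Fin n → OracleState d} {now : ℝ≥0} {l : Ledger n}

theorem Ledger.valid_empty (v : Fin n → ℝ → ℝ) (M : ℝ) :
    (Ledger.empty n).Valid v M (fun _ => OracleState.idle d) 0 := by
  constructor <;> simp [Ledger.empty, OracleState.idle, lowerTime]

theorem Ledger.Valid.mono (h : l.Valid v M S now) {t : ℝ≥0} (ht : now ≤ t) : l.Valid v M S t :=
  { h with
    start_le := h.start_le.trans ht
    count_le := fun i => (h.count_le i).trans (work_mono_right _ _ (by exact_mod_cast ht))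
    time_le := fun i hi => (h.time_le i hi).trans ht }

theorem busy_of_update_idle {w i : Fin n}
    (hi : (Function.update S w (OracleState.idle d) i).busy = true) : i ≠ w := by
  rintro rfl
  simp [OracleState.idle] at hi

theorem Ledger.Valid.idle (h : l.Valid v M S now) (w : Fin n) :
    l.Valid v M (Function.update S w (OracleState.idle d)) now := by
  constructor
  case stamp_le => exact h.stamp_le
  case start_le => exact h.start_le
  case lowerTime_le => exact h.lowerTime_le
  case start_pos => exact h.start_pos
  case count_le => exact h.count_le
  all_goals
    intro i hi
    have hw := busy_of_update_idle hi
    rw [Function.update_of_ne hw] at hi ⊢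
  · exact h.suppLT i hi
  · exact h.time_le i hi
  · exact h.start_le_time i hi
  · exact h.count_le_time i hi

theorem Ledger.Valid.begin (h : l.Valid v M S now) (w : Fin n) {x : Pt d} (hx : SuppLT l.level x) :
    Ledger.Valid v M (Function.update S w ⟨now, x, true⟩) now
      { l with stamp := Function.update l.stamp w l.level } := by
  constructor
  case start_le => exact h.start_le
  case lowerTime_le => exact h.lowerTime_le
  case start_pos => exact h.start_pos
  case count_le => exact h.count_le
  all_goals
    intro i
    rcases eq_or_ne i w with rfl | hw
    · simp [hx, h.start_le, h.count_le]
    simp only [Function.update_of_ne hw]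
  · exact h.stamp_le i
  · exact h.suppLT i
  · exact h.time_le i
  · exact h.start_le_time i
  · exact h.count_le_time i

/-- Work is additive: the old trials of the worker lie between the start of the level and the start
of the running computation, and the new trial spends one unit after that. -/
theorem Ledger.Valid.count_add_one_le (h : l.Valid v M S now) {q : Query n d}
    (hq : now ≤ q.time) (ht : IsTrial v S l q) (i : Fin n) :
    ((Function.update l.count q.worker (l.count q.worker + 1) i : ℕ) : ℝ≥0∞) ≤
      work (v i) l.start q.time := by
  rcases eq_or_ne i q.worker with rfl | hw
  · obtain ⟨-, hb, hwork, hs⟩ := ht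
    rw [Function.update_self]
    push_cast
    refine (add_le_add (h.count_le_time _ hb hs) hwork).trans (work_add_le _ ?_ ?_)
    · exact_mod_cast h.start_le_time _ hb hs
    · exact_mod_cast (h.time_le _ hb).trans hq
  · rw [Function.update_of_ne hw]
    exact (h.mono hq).count_le i

theorem Ledger.Valid.fail (h : l.Valid v M S now) {q : Query n d} (hq : now ≤ q.time)
    (ht : IsTrial v S l q) :
    Ledger.Valid v M (Function.update S q.worker (OracleState.idle d)) q.time
      { l with count := Function.update l.count q.worker (l.count q.worker + 1) } :=
  { (h.mono hq).idle q.worker with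
    count_le := h.count_add_one_le hq ht
    count_le_time := fun i hi => by
      have hw := busy_of_update_idle hi
      simp only [Function.update_of_ne hw] at hi ⊢
      exact h.count_le_time i hi }

theorem Ledger.Valid.success (h : l.Valid v M S now) {q : Query n d} (hq : now ≤ q.time)
    (ht : IsTrial v S l q) {m : ℕ} (hm : M ≤ m) :
    Ledger.Valid v M (Function.update S q.worker (OracleState.idle d)) q.time
      ⟨l.level + 1, q.time, if m ≤ l.trials + 1 then l.long + 1 else l.long, l.stamp, 0⟩ where
  stamp_le i := (h.stamp_le i).trans (Nat.le_succ _)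
  suppLT := (h.idle q.worker).suppLT
  start_le := le_rfl
  lowerTime_le := by
    simp only
    split_ifs with hl
    · refine lowerTime_succ_le hm h.lowerTime_le (h.count_add_one_le hq ht) ?_
      rwa [Ledger.sum_update_count]
    · refine h.lowerTime_le.trans ?_
      exact_mod_cast h.start_le.trans hq
  start_pos _ := by
    rw [pos_iff_ne_zero]
    intro h0
    have h0' : q.time = 0 := h0
    have hwork := ht.2.2.1
    rw [work_eq_zero _ (by simp [h0'])] at hwork
    simp at hwork
  count_le i := by simp
  time_le := ((h.mono hq).idle q.worker).time_le
  start_le_time i _ hs := by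
    -- Every running computation is outdated at the new level, so the conditions on current stamps
    -- hold vacuously.
    have := h.stamp_le i
    simp only at hs
    omega
  count_le_time i _ hs := by simp

/-- A stochastic gradient mapping that reveals at most the next coordinate, and nothing new if the
sample is `false`. -/
structure RevealsNext (G : Pt d → Bool → Pt d) : Prop where
  suppLT : ∀ {ℓ x}, SuppLT ℓ x → ∀ ξ, SuppLT (ℓ + 1) (G x ξ)
  suppLT_false : ∀ {ℓ x}, SuppLT ℓ x → SuppLT ℓ (G x false)

theorem Ledger.Valid.step (h : l.Valid v M S now) {q : Query n d} (hq : now ≤ q.time)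
    (hx : SuppLT l.level q.point) {m : ℕ} (hm : M ≤ m) {G : Pt d → Bool → Pt d}
    (hG : RevealsNext G) (ξ : Bool) :
    (l.step v m S q ξ).Valid v M (Function.update S q.worker
      (oracle (v q.worker) (fun x ξ _ => G x ξ) ξ q.time q.point (S q.worker) q.cancel).1) q.time ∧
    SuppLT (l.step v m S q ξ).level
      (oracle (v q.worker) (fun x ξ _ => G x ξ) ξ q.time q.point (S q.worker) q.cancel).2 := by
  unfold oracle Ledger.step
  by_cases hc : q.cancel = true
  · have ht : ¬ IsTrial v S l q := fun h => by simp [h.1] at hc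
    rw [if_neg ht, if_pos hc, if_neg (by simp [hc])]
    exact ⟨(h.mono hq).idle _, SuppLT.zero _⟩
  rw [if_neg hc]
  rw [Bool.not_eq_true] at hc
  by_cases hb : (S q.worker).busy = false
  · have ht : ¬ IsTrial v S l q := fun h => by simp [h.2.1] at hb
    rw [if_neg ht, if_pos hb, if_pos ⟨hc, hb⟩]
    exact ⟨(h.mono hq).begin _ hx, SuppLT.zero _⟩
  rw [if_neg hb, if_neg (fun h : q.cancel = false ∧ (S q.worker).busy = false => hb h.2)]
  rw [Bool.not_eq_false] at hb
  by_cases hw : work (v q.worker) (S q.worker).time q.time < 1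
  · have ht : ¬ IsTrial v S l q := fun h => absurd h.2.2.1 (not_le.2 hw)
    rw [if_neg ht, if_pos hw]
    simp only [Function.update_eq_self]
    exact ⟨h.mono hq, SuppLT.zero _⟩
  rw [if_neg hw]
  have hS := h.suppLT _ hb
  by_cases hs : l.stamp q.worker = l.level
  · have ht : IsTrial v S l q := ⟨hc, hb, not_lt.1 hw, hs⟩
    rw [hs] at hS
    rw [if_pos ht]
    cases ξ
    · simp only [Bool.false_eq_true, if_false]
      exact ⟨h.fail hq ht, hG.suppLT_false hS⟩
    · simp only [if_true]
      exact ⟨h.success hq ht hm, hG.suppLT hS true⟩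
  · have ht : ¬ IsTrial v S l q := fun h => hs h.2.2.2
    rw [if_neg ht]
    -- An outdated computation was begun at a strictly lower level, so even a successful coin
    -- reveals nothing beyond the current one.
    have := h.stamp_le q.worker
    exact ⟨(h.mono hq).idle _, (hG.suppLT hS ξ).mono (by omega)⟩

theorem Ledger.level_le_step (v : Fin n → ℝ → ℝ) (m : ℕ) (S : Fin n → OracleState d) (l : Ledger n)
    (q : Query n d) (ξ : Bool) : l.level ≤ (l.step v m S q ξ).level := by
  unfold Ledger.step
  split_ifs <;> simp

end Valid

/-! ### The ledger along the protocol -/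

section Protocol

variable (v : Fin n → ℝ → ℝ) (G : Pt d → Bool → Pt d) (A : Algorithm n d) (m : ℕ)

/-- The states of the workers before iteration `k`. -/
def states (ω : ℕ → Bool) (k : ℕ) : Fin n → OracleState d :=
  (run v (fun _ x ξ _ => G x ξ) A ω k).1

/-- The query of iteration `k`. -/
def query (ω : ℕ → Bool) (k : ℕ) : Query n d := A k (run v (fun _ x ξ _ => G x ξ) A ω k).2

/-- The ledger before iteration `k`. -/
def ledger (ω : ℕ → Bool) : ℕ → Ledger n
  | 0 => Ledger.empty n
  | k + 1 => (ledger ω k).step v m (states v G A ω k) (query v G A ω k) (ω k)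

variable {v G A m}

theorem iterTime_le_query_time (hA : A.IsZeroRespecting) (ω : ℕ → Bool) (k : ℕ) :
    iterTime v (fun _ x ξ _ => G x ξ) A ω k ≤ (query v G A ω k).time := by
  cases k with
  | zero => exact zero_le
  | succ k =>
    have := hA.time_mono k (run v (fun _ x ξ _ => G x ξ) A ω (k + 1)).2
    simpa [run, iterTime, query] using this

theorem suppLT_of_isZeroRespecting (hA : A.IsZeroRespecting) {k ℓ : ℕ} {g : Fin k → Pt d}
    (hg : ∀ j, SuppLT ℓ (g j)) : SuppLT ℓ (A k g).point := fun i hi => by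
  by_contra hne
  obtain ⟨j, hj⟩ := hA.supp_subset k g i hne
  exact hj (hg j i hi)

theorem ledger_valid (hA : A.IsZeroRespecting) (hG : RevealsNext G) {M : ℝ} (hm : M ≤ m)
    (ω : ℕ → Bool) (k : ℕ) :
    (ledger v G A m ω k).Valid v M (states v G A ω k)
      (iterTime v (fun _ x ξ _ => G x ξ) A ω k) ∧
    ∀ j, SuppLT (ledger v G A m ω k).level ((run v (fun _ x ξ _ => G x ξ) A ω k).2 j) := by
  induction k with
  | zero => exact ⟨Ledger.valid_empty v M, fun j => j.elim0⟩
  | succ k ih =>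
    obtain ⟨h1, h2⟩ := ih
    have hs := h1.step (iterTime_le_query_time hA ω k) (suppLT_of_isZeroRespecting hA h2) hm hG (ω k)
    refine ⟨hs.1, fun j => ?_⟩
    refine Fin.lastCases ?_ (fun j => ?_) j
    · simp only [run, Fin.snoc_last]
      exact hs.2
    · simp only [run, Fin.snoc_castSucc]
      exact (h2 j).mono (Ledger.level_le_step ..)

theorem suppLT_iterPoint (hA : A.IsZeroRespecting) (hG : RevealsNext G)
    (ω : ℕ → Bool) (k : ℕ) :
    SuppLT (ledger v G A m ω k).level (iterPoint v (fun _ x ξ _ => G x ξ) A ω k) :=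
  suppLT_of_isZeroRespecting hA (ledger_valid hA hG (M := m) le_rfl ω k).2

variable (v G A m)

/-- Iteration `k` is a trial of one of the first `T` levels whose success makes the level short. -/
def IsEarlyTrial (T : ℕ) (ω : ℕ → Bool) (k : ℕ) : Prop :=
  IsTrial v (states v G A ω k) (ledger v G A m ω k) (query v G A ω k) ∧
    (ledger v G A m ω k).trials + 1 < m ∧ (ledger v G A m ω k).level < T

-- An early trial is one of the first `m - 1` trials of its level, and only the first `T` levels
-- count.
open Classical in
theorem card_earlyTrial_le (T : ℕ) (ω : ℕ → Bool) (k : ℕ) :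
    (∑ j ∈ Finset.range k, if IsEarlyTrial v G A m T ω j then 1 else 0) ≤ T * (m - 1) := by
  -- The bound strengthened for induction: `m - 1` for each finished level, and the trials so far,
  -- capped at `m - 1`, for the current one.
  have key : (∑ j ∈ Finset.range k, if IsEarlyTrial v G A m T ω j then 1 else 0) ≤
      min (ledger v G A m ω k).level T * (m - 1) +
        if (ledger v G A m ω k).level < T then min (ledger v G A m ω k).trials (m - 1) else 0 := by
    induction k with
    | zero => simp
    | succ k ih =>
      rw [Finset.sum_range_succ]
      have hE : IsEarlyTrial v G A m T ω k ↔
        IsTrial v (states v G A ω k) (ledger v G A m ω k) (query v G A ω k) ∧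
          (ledger v G A m ω k).trials + 1 < m ∧ (ledger v G A m ω k).level < T := Iff.rfl
      have hl : ledger v G A m ω (k + 1) = (ledger v G A m ω k).step v m (states v G A ω k)
        (query v G A ω k) (ω k) := rfl
      rw [hl]
      clear hl
      revert ih hE
      generalize ledger v G A m ω k = l
      generalize IsEarlyTrial v G A m T ω k = E
      generalize (∑ j ∈ Finset.range k, if IsEarlyTrial v G A m T ω j then 1 else 0) = s
      intro ih hE
      by_cases ht : IsTrial v (states v G A ω k) l (query v G A ω k)
      · cases hω : ω k
        · have h1 : (l.step v m (states v G A ω k) (query v G A ω k) false).trials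
              = l.trials + 1 := by
            simp only [Ledger.step, ht, if_true, Bool.false_eq_true, if_false]
            exact l.sum_update_count _
          have h2 : (l.step v m (states v G A ω k) (query v G A ω k) false).level = l.level := by
            simp [Ledger.step, ht]
          rw [h1, h2]
          by_cases hlT : l.level < T <;> by_cases htr : l.trials + 1 < m <;>
            simp only [hE, ht, hlT, htr, and_true, and_false, if_true, if_false] at ih ⊢
            <;> omega
        · have h2 : (l.step v m (states v G A ω k) (query v G A ω k) true).level
              = l.level + 1 := by
            simp [Ledger.step, ht]
          rw [h2]
          by_cases hlT : l.level < T
          · have h3 : min (l.level + 1) T = min l.level T + 1 := by omega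
            rw [h3, Nat.add_mul]
            by_cases htr : l.trials + 1 < m <;>
              simp only [hE, ht, hlT, htr, and_true, and_false, if_true, if_false] at ih ⊢
              <;> omega
          · have h3 : min (l.level + 1) T = min l.level T := by omega
            rw [h3]
            simp only [hE, hlT, and_false, if_false] at ih ⊢
            omega
      · have h1 : (l.step v m (states v G A ω k) (query v G A ω k) (ω k)).trials = l.trials := by
          simp only [Ledger.step, ht, if_false]
          split_ifs <;> rfl
        have h2 : (l.step v m (states v G A ω k) (query v G A ω k) (ω k)).level = l.level := by
          simp only [Ledger.step, ht, if_false]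
          split_ifs <;> rfl
        rw [h1, h2]
        simpa [hE, ht] using ih
  refine key.trans ?_
  split_ifs with hlT
  · calc min (ledger v G A m ω k).level T * (m - 1) + min (ledger v G A m ω k).trials (m - 1)
        ≤ (ledger v G A m ω k).level * (m - 1) + (m - 1) := 
          Nat.add_le_add (Nat.mul_le_mul_right _ (min_le_left _ _)) (min_le_right _ _)
      _ = ((ledger v G A m ω k).level + 1) * (m - 1) := by ring
      _ ≤ T * (m - 1) := Nat.mul_le_mul_right _ hlT
  · simpa using Nat.mul_le_mul_right (m - 1) (min_le_right _ T)

-- Below `T`, each gain of a level is a successful trial, which either makes the level long or is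
-- early.
open Classical in
theorem level_le_long_add (T : ℕ) (ω : ℕ → Bool) (k : ℕ) :
    min (ledger v G A m ω k).level T ≤ (ledger v G A m ω k).long +
      ∑ j ∈ Finset.range k, if IsEarlyTrial v G A m T ω j ∧ ω j = true then 1 else 0 := by
  induction k with
  | zero => simp [ledger, Ledger.empty]
  | succ k ih =>
    rw [Finset.sum_range_succ]
    have hE : IsEarlyTrial v G A m T ω k ↔
      IsTrial v (states v G A ω k) (ledger v G A m ω k) (query v G A ω k) ∧
        (ledger v G A m ω k).trials + 1 < m ∧ (ledger v G A m ω k).level < T := Iff.rfl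
    simp only [ledger]
    revert ih hE
    generalize ledger v G A m ω k = l
    generalize IsEarlyTrial v G A m T ω k = E
    generalize (∑ j ∈ Finset.range k,
      if IsEarlyTrial v G A m T ω j ∧ ω j = true then 1 else 0) = s
    intro ih hE
    by_cases ht : IsTrial v (states v G A ω k) l (query v G A ω k)
    · cases hω : ω k
      · simp only [Ledger.step, ht, if_true, Bool.false_eq_true, if_false]
        omega
      · simp only [Ledger.step, ht, if_true, hE, true_and, and_true]
        split_ifs <;> omega
    · simp only [Ledger.step, ht, if_false]
      split_ifs <;> first | omega | (simp only; omega)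

end Protocol

/-! ### Events that depend on finitely many samples -/

theorem run_congr {Ξ : Type} (v : Fin n → ℝ → ℝ) (g : Fin n → Pt d → Ξ → ℝ≥0 → Pt d)
    (A : Algorithm n d) {ω ω' : ℕ → Ξ} {k : ℕ} (h : ∀ j < k, ω j = ω' j) :
    run v g A ω k = run v g A ω' k := by
  induction k with
  | zero => rfl
  | succ k ih => simp only [run, ih fun j hj => h j (hj.trans k.lt_succ_self), h k k.lt_succ_self]

theorem ledger_congr (v : Fin n → ℝ → ℝ) (G : Pt d → Bool → Pt d) (A : Algorithm n d) (m : ℕ)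
    {ω ω' : ℕ → Bool} {k : ℕ} (h : ∀ j < k, ω j = ω' j) :
    ledger v G A m ω k = ledger v G A m ω' k := by
  induction k with
  | zero => rfl
  | succ k ih =>
    have h' : ∀ j < k, ω j = ω' j := fun j hj => h j (hj.trans k.lt_succ_self)
    simp only [ledger, ih h', h k k.lt_succ_self, states, query, run_congr v _ A h']

theorem isEarlyTrial_congr (v : Fin n → ℝ → ℝ) (G : Pt d → Bool → Pt d) (A : Algorithm n d)
    (m T : ℕ) {ω ω' : ℕ → Bool} {k : ℕ} (h : ∀ j < k, ω j = ω' j) :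
    IsEarlyTrial v G A m T ω k ↔ IsEarlyTrial v G A m T ω' k := by
  simp only [IsEarlyTrial, states, query, ledger_congr v G A m h, run_congr v _ A h]

/-- The sample sequence with the first values `y`, continued by `false`. -/
def extendFalse (k : ℕ) (y : Finset.range k → Bool) (j : ℕ) : Bool :=
  if h : j ∈ Finset.range k then y ⟨j, h⟩ else false

theorem eq_extendFalse {α : Type*} {F : (ℕ → Bool) → α} {k : ℕ}
    (h : ∀ ω ω', (∀ j < k, ω j = ω' j) → F ω = F ω') (ω : ℕ → Bool) :
    F ω = F (extendFalse k fun j => ω j) :=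
  h _ _ fun j hj => by simp [extendFalse, hj]

/-- Such a map factors through the finite discrete space of the first `k` samples, so the algorithm
itself need not be measurable. -/
theorem measurable_of_forall_lt {α : Type*} [MeasurableSpace α] {F : (ℕ → Bool) → α} {k : ℕ}
    (h : ∀ ω ω', (∀ j < k, ω j = ω' j) → F ω = F ω') : Measurable F := by
  have hF : F = (fun y => F (extendFalse k y)) ∘ fun ω (j : Finset.range k) => ω j :=
    funext (eq_extendFalse h)
  rw [hF]
  exact Measurable.of_discrete.comp (measurable_pi_lambda _ fun j => measurable_pi_apply _)

theorem measurable_bestGradSq (v : Fin n → ℝ → ℝ) (G : Pt d → Bool → Pt d) (A : Algorithm n d)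
    (f : Pt d → ℝ) (t : ℝ≥0∞) : Measurable (bestGradSq v (fun _ x ξ _ => G x ξ) A f t) := by
  refine Measurable.iInf fun k => measurable_of_forall_lt (k := k) fun ω ω' h => ?_
  have h1 : iterPoint v (fun _ x ξ _ => G x ξ) A ω k = iterPoint v (fun _ x ξ _ => G x ξ) A ω' k := by
    simp only [iterPoint, run_congr v _ A h]
  have h2 : iterTime v (fun _ x ξ _ => G x ξ) A ω k = iterTime v (fun _ x ξ _ => G x ξ) A ω' k := by
    cases k with
    | zero => rfl
    | succ k => simp only [iterTime, run_congr v _ A fun j hj => h j (hj.trans k.lt_succ_self)]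
  simp only [Set.mem_ofPred_eq, h1, h2]

/-- The event is decided by the samples before `k`, which are independent of sample `k`. -/
theorem measure_inter_true (p : ℝ) [IsProbabilityMeasure (coin p)] {E : (ℕ → Bool) → Prop} {k : ℕ}
    (h : ∀ ω ω', (∀ j < k, ω j = ω' j) → (E ω ↔ E ω')) :
    Measure.infinitePi (fun _ : ℕ => coin p) {ω | E ω ∧ ω k = true} =
      ENNReal.ofReal p * Measure.infinitePi (fun _ : ℕ => coin p) {ω | E ω} := by
  have hind := (ProbabilityTheory.iIndepFun_infinitePi (P := fun _ : ℕ => coin p)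
    (X := fun _ b => b) (fun _ => measurable_id)).indepFun_finset (Finset.range k) {k}
    (by simp) (fun j => measurable_pi_apply j)
  have h1 := hind.measure_inter_preimage_eq_mul {y | E (extendFalse k y)}
    {y | y ⟨k, Finset.mem_singleton_self k⟩ = true} (Set.toFinite _).measurableSet
    (Set.toFinite _).measurableSet
  have hE : (fun ω (j : Finset.range k) => ω j) ⁻¹' {y | E (extendFalse k y)} =
      {ω : ℕ → Bool | E ω} := by
    ext ω
    exact (eq_extendFalse (F := E) (fun ω ω' hω => propext (h ω ω' hω)) ω).symm.to_iff
  have hk : Measure.infinitePi (fun _ : ℕ => coin p) {ω | ω k = true} = ENNReal.ofReal p := by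
    rw [← coin_true p, ← (measurePreserving_eval_infinitePi (fun _ : ℕ => coin p) k).measure_preimage
      (Set.toFinite _).measurableSet.nullMeasurableSet]
    rfl
  rw [hE] at h1
  rw [mul_comm, ← hk]
  exact h1

/-! ### The number of short levels -/

section Short

variable (v : Fin n → ℝ → ℝ) (G : Pt d → Bool → Pt d) (A : Algorithm n d) (m T : ℕ)

open Classical in
/-- The number of short levels among the first `T` levels. -/
def shortLevels (ω : ℕ → Bool) : ℝ≥0∞ :=
  ∑' k, if IsEarlyTrial v G A m T ω k ∧ ω k = true then 1 else 0

theorem measurable_shortLevels : Measurable (shortLevels v G A m T) := by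
  classical
  refine Measurable.tsum fun k => measurable_of_forall_lt (k := k + 1) fun ω ω' h => ?_
  simp only [isEarlyTrial_congr v G A m T fun j hj => h j (Nat.lt_succ_of_lt hj),
    h k k.lt_succ_self]

/-- A Wald-type identity: summed over iterations, the expected number of successful early trials is
`p` times the expected number of early trials, and the latter number is bounded surely. -/
theorem lintegral_shortLevels_le (p : ℝ) [IsProbabilityMeasure (coin p)] :
    ∫⁻ ω, shortLevels v G A m T ω ∂(Measure.infinitePi fun _ : ℕ => coin p) ≤
      ENNReal.ofReal p * (T * (m - 1 : ℕ) : ℕ) := by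
  classical
  set μ := Measure.infinitePi fun _ : ℕ => coin p with hμ
  have hm1 : ∀ k, MeasurableSet {ω | IsEarlyTrial v G A m T ω k ∧ ω k = true} := fun k =>
    measurableSet_setOfPred.2 <| measurable_of_forall_lt (k := k + 1) fun ω ω' h => by
      simp only [isEarlyTrial_congr v G A m T fun j hj => h j (Nat.lt_succ_of_lt hj),
        h k k.lt_succ_self]
  have hm0 : ∀ k, MeasurableSet {ω | IsEarlyTrial v G A m T ω k} := fun k =>
    measurableSet_setOfPred.2 <| measurable_of_forall_lt (k := k) fun ω ω' h => by
      simp only [isEarlyTrial_congr v G A m T h]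
  have hl : ∀ {P : (ℕ → Bool) → Prop} [DecidablePred P], MeasurableSet {ω | P ω} →
      ∫⁻ ω, (if P ω then 1 else 0) ∂μ = μ {ω | P ω} := fun {P} _ hP => by
    rw [← lintegral_indicator_one hP]
    exact lintegral_congr fun ω => by simp [Set.indicator_apply]
  calc ∫⁻ ω, shortLevels v G A m T ω ∂μ
      = ∑' k, μ {ω | IsEarlyTrial v G A m T ω k ∧ ω k = true} := by
        unfold shortLevels
        rw [lintegral_tsum fun k =>
          (Measurable.ite (hm1 k) measurable_const measurable_const).aemeasurable]
        exact tsum_congr fun k => hl (hm1 k)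
    _ = ∑' k, ENNReal.ofReal p * μ {ω | IsEarlyTrial v G A m T ω k} :=
        tsum_congr fun k => measure_inter_true p fun ω ω' h => isEarlyTrial_congr v G A m T h
    _ = ENNReal.ofReal p * ∫⁻ ω, ∑' k, (if IsEarlyTrial v G A m T ω k then 1 else 0) ∂μ := by
        rw [ENNReal.tsum_mul_left, lintegral_tsum fun k =>
          (Measurable.ite (hm0 k) measurable_const measurable_const).aemeasurable]
        congr 1
        exact tsum_congr fun k => (hl (hm0 k)).symm
    _ ≤ ENNReal.ofReal p * ∫⁻ _, ((T * (m - 1 : ℕ) : ℕ) : ℝ≥0∞) ∂μ := by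
        gcongr with ω
        refine ENNReal.tsum_le_of_sum_range_le fun k => ?_
        have := card_earlyTrial_le v G A m T ω k
        calc (∑ j ∈ Finset.range k, if IsEarlyTrial v G A m T ω j then (1 : ℝ≥0∞) else 0)
            = ((∑ j ∈ Finset.range k, if IsEarlyTrial v G A m T ω j then 1 else 0 : ℕ) : ℝ≥0∞) := by
              push_cast; rfl
          _ ≤ _ := by exact_mod_cast this
    _ = ENNReal.ofReal p * (T * (m - 1 : ℕ) : ℕ) := by simp

/-- If the chance of success in a trial is small compared to `1 / m`, then with probability at least
`1 / 2` fewer than half of the first `T` levels are short. -/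
theorem half_le_measure_shortLevels {p : ℝ} [IsProbabilityMeasure (coin p)] (hp : 0 ≤ p)
    (hT : 1 ≤ T) (hpm : p * (m - 1 : ℕ) ≤ 1 / 4) :
    1 / 2 ≤ Measure.infinitePi (fun _ : ℕ => coin p)
      {ω | shortLevels v G A m T ω < ENNReal.ofReal (T / 2)} := by
  set μ := Measure.infinitePi fun _ : ℕ => coin p with hμ
  have hT0 : (0 : ℝ) < T := by exact_mod_cast hT
  have h1 := (mul_meas_ge_le_lintegral (μ := μ) (measurable_shortLevels v G A m T)
    (ENNReal.ofReal (T / 2))).trans (lintegral_shortLevels_le v G A m T p)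
  have h2 : ENNReal.ofReal p * (T * (m - 1 : ℕ) : ℕ) ≤ ENNReal.ofReal (T / 2) * (1 / 2) := by
    rw [show (1 / 2 : ℝ≥0∞) = ENNReal.ofReal (1 / 2) by
        rw [ENNReal.ofReal_div_of_pos (by norm_num)]; simp,
      ← ENNReal.ofReal_natCast (T * (m - 1)), ← ENNReal.ofReal_mul hp,
      ← ENNReal.ofReal_mul (by positivity)]
    refine ENNReal.ofReal_le_ofReal ?_
    push_cast
    nlinarith
  have h3 : μ {ω | ENNReal.ofReal (T / 2) ≤ shortLevels v G A m T ω} ≤ 1 / 2 :=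
    (ENNReal.mul_le_mul_iff_right (ENNReal.ofReal_pos.2 (by positivity)).ne'
      ENNReal.ofReal_ne_top).1 (h1.trans h2)
  have h4 : {ω | shortLevels v G A m T ω < ENNReal.ofReal (T / 2)} =
      {ω | ENNReal.ofReal (T / 2) ≤ shortLevels v G A m T ω}ᶜ := by
    ext ω
    simp
  rw [h4, prob_compl_eq_one_sub (measurableSet_le measurable_const
    (measurable_shortLevels v G A m T))]
  calc (1 / 2 : ℝ≥0∞) = 1 - 1 / 2 := by simp [ENNReal.one_sub_inv_two]
    _ ≤ _ := tsub_le_tsub_left h3 1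

variable {v G A m T}

/-- If fewer than half of the first `T` levels are short, then level `T` is not reached before
half of the lower time number `K ≤ T / 2`. -/
theorem level_lt_of_shortLevels (hA : A.IsZeroRespecting) (hG : RevealsNext G) {M : ℝ} (hM : 0 < M)
    (hm : M ≤ m) (hT : 1 ≤ T) {K : ℕ} (hK : 2 * K ≤ T) {ω : ℕ → Bool}
    (hω : shortLevels v G A m T ω < ENNReal.ofReal (T / 2)) {k : ℕ}
    (hk : (iterTime v (fun _ x ξ _ => G x ξ) A ω k : ℝ≥0∞) ≤ lowerTime v M K / 2) :
    (ledger v G A m ω k).level < T := by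
  classical
  by_contra! hlev
  have hV := (ledger_valid (v := v) (m := m) hA hG hm ω k).1
  have h1 := level_le_long_add v G A m T ω k
  have h2 := (ENNReal.sum_le_tsum (f := fun k => if IsEarlyTrial v G A m T ω k ∧ ω k = true then
    (1 : ℝ≥0∞) else 0) (Finset.range k)).trans_lt hω
  have h3 : ((∑ j ∈ Finset.range k,
      if IsEarlyTrial v G A m T ω j ∧ ω j = true then 1 else 0 : ℕ) : ℝ) < T / 2 := by
    rw [← ENNReal.ofReal_lt_ofReal_iff (by positivity), ENNReal.ofReal_natCast]
    push_cast
    exact h2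
  rw [min_eq_right hlev] at h1
  -- `T ≤ long + short`, `2 * short < T` and `2 * K ≤ T`.
  have hlong : K ≤ (ledger v G A m ω k).long := by
    rw [lt_div_iff₀ (by norm_num)] at h3
    have h4 : (∑ j ∈ Finset.range k,
      if IsEarlyTrial v G A m T ω j ∧ ω j = true then 1 else 0) * 2 < T := by exact_mod_cast h3
    omega
  have h5 : lowerTime v M K ≤ (iterTime v (fun _ x ξ _ => G x ξ) A ω k : ℝ≥0∞) :=
    (lowerTime_mono v hM hlong).trans
      (hV.lowerTime_le.trans (by exact_mod_cast hV.start_le))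
  have h6 : 0 < iterTime v (fun _ x ξ _ => G x ξ) A ω k :=
    (hV.start_pos (by omega)).trans_le hV.start_le
  have h7 : lowerTime v M K ≠ ∞ := ne_top_of_le_ne_top ENNReal.coe_ne_top h5
  -- This covers `K = 0`: reaching a level takes positive time. An infinite `lowerTime` was excluded
  -- by `h7`, since protocol times are finite.
  have h8 : lowerTime v M K ≠ 0 := by
    intro h0
    rw [h0] at hk
    simp at hk
    exact h6.ne' hk
  exact absurd (h5.trans hk) (not_le.2 (ENNReal.half_lt_self h8 h7))

end Short

/-! ### The expected gradient bound for the noisy oracle -/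

theorem revealsNext_noisy {f' : Pt d → Pt d} (p : ℝ)
    (h : ∀ (x : Pt d) (ℓ : ℕ), (∀ i : Fin d, ℓ ≤ i → x i = 0) → ∀ i : Fin d, ℓ < i → f' x i = 0) :
    RevealsNext (noisy f' p) where
  suppLT hx ξ i hi := noisy_apply_eq_zero p ξ (h _ _ hx i hi)
  suppLT_false hx _ hi := noisy_false_apply_eq_zero f' p fun j hj => hx j (hi.trans hj)

/-- The lower bound for a gradient field that stays large below level `T`. -/
theorem lt_lintegral_bestGradSq {v : Fin n → ℝ → ℝ} {A : Algorithm n d} (hA : A.IsZeroRespecting)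
    {G : Pt d → Bool → Pt d} (hG : RevealsNext G) {f : Pt d → ℝ} {ε p M : ℝ} {T K : ℕ}
    [IsProbabilityMeasure (coin p)] (hε : 0 < ε) (hp : 0 ≤ p) (hM : 0 < M) (hpM : p * M ≤ 1 / 4)
    (hT : 1 ≤ T) (hK : 2 * K ≤ T)
    (hf : ∀ x, (∀ i : Fin d, T ≤ i + 1 → x i = 0) → 4 * ε ≤ ‖gradient f x‖ ^ 2) :
    ENNReal.ofReal ε < ∫⁻ ω, bestGradSq v (fun _ x ξ _ => G x ξ) A f (lowerTime v M K / 2) ω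
      ∂(Measure.infinitePi fun _ : ℕ => coin p) := by
  set m := ⌈M⌉₊ with hm
  set μ := Measure.infinitePi fun _ : ℕ => coin p with hμ
  -- Rounding up costs nothing, since only `m - 1` trials per level are early; for `M ≤ 1` there are
  -- none.
  have hm1 : ((m - 1 : ℕ) : ℝ) ≤ M := by
    rw [Nat.cast_sub (Nat.one_le_ceil_iff.2 hM), Nat.cast_one]
    linarith [Nat.ceil_lt_add_one hM.le]
  have hhalf := half_le_measure_shortLevels v G A m T hp hT
    ((mul_le_mul_of_nonneg_left hm1 hp).trans hpM)
  have hbest : ∀ ω ∈ {ω | shortLevels v G A m T ω < ENNReal.ofReal (T / 2)},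
      ENNReal.ofReal (4 * ε) ≤
        bestGradSq v (fun _ x ξ _ => G x ξ) A f (lowerTime v M K / 2) ω := by
    intro ω hω
    refine le_iInf₂ fun k hk => ENNReal.ofReal_le_ofReal (hf _ fun i hi => ?_)
    have hlev := level_lt_of_shortLevels (m := m) hA hG hM (Nat.le_ceil M) hT hK hω hk
    exact suppLT_iterPoint (m := m) hA hG ω k i (by omega)
  calc ENNReal.ofReal ε < ENNReal.ofReal (4 * ε * (1 / 2)) :=
        (ENNReal.ofReal_lt_ofReal_iff (by positivity)).2 (by linarith)
    _ = ENNReal.ofReal (4 * ε) * (1 / 2) := by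
        rw [ENNReal.ofReal_mul (by positivity), ENNReal.ofReal_div_of_pos (by norm_num)]
        simp
    _ ≤ ENNReal.ofReal (4 * ε) * μ {ω | ENNReal.ofReal (4 * ε) ≤
          bestGradSq v (fun _ x ξ _ => G x ξ) A f (lowerTime v M K / 2) ω} := by
        gcongr
        exact hhalf.trans (measure_mono hbest)
    _ ≤ _ := mul_meas_ge_le_lintegral (measurable_bestGradSq v G A f _) _

end TimeOracle

end

/-- The stochastic gradient mapping `G` is the same for all workers and times, i.e.
`g_i(x; ξ, t) = G(x, ξ)`; the samples of different iterations are independent with law `D`. -/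
theorem theorem1 :
    ∃ c' c₁ c₂ : ℝ, 0 < c' ∧ 0 < c₁ ∧ 0 < c₂ ∧
      ∀ L Δ ε : ℝ, 0 < L → 0 < Δ → 0 < ε → ε < c' * L * Δ →
      ∃ d₀ : ℕ, ∀ d : ℕ, d₀ ≤ d →
      ∀ (n : ℕ) (v : Fin n → ℝ → ℝ), (∀ i, TimeOracle.IsComputationPower (v i)) →
      ∀ (σ : ℝ) (A : TimeOracle.Algorithm n d), A.IsZeroRespecting →
      ∃ f : TimeOracle.Pt d → ℝ,
        TimeOracle.IsSmooth L f ∧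
        (∃ fstar : ℝ, (∀ x, fstar ≤ f x) ∧ f 0 - fstar ≤ Δ) ∧
        ∃ (Ξ : Type) (_ : MeasurableSpace Ξ) (D : Measure Ξ) (_ : IsProbabilityMeasure D)
          (G : TimeOracle.Pt d → Ξ → TimeOracle.Pt d),
          TimeOracle.IsStochasticGradient D f σ G ∧
          Measurable (TimeOracle.bestGradSq v (fun _ x ξ _ => G x ξ) A f
            (TimeOracle.lowerTime v (c₂ * max (⌈σ ^ 2 / ε⌉₊ : ℝ) 1) ⌊c₁ * (L * Δ / ε)⌋₊ / 2)) ∧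
          ENNReal.ofReal ε <
            ∫⁻ ω, TimeOracle.bestGradSq v (fun _ x ξ _ => G x ξ) A f
              (TimeOracle.lowerTime v (c₂ * max (⌈σ ^ 2 / ε⌉₊ : ℝ) 1) ⌊c₁ * (L * Δ / ε)⌋₊ / 2) ω
              ∂(Measure.infinitePi fun _ : ℕ => D) := by
  -- `12288 = 4 · 3072`: the chain has about `R / 3072` coordinates and `K ≤ R / 12288`, so `2 * K ≤
  -- T` survives the rounding once `R > 12288`. The factor `1/256` gives `p * M ≤ 64 (r + 1) / (256
  -- (64 + r)) ≤ 1/4`.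
  refine ⟨1 / 12288, 1 / 12288, 1 / 256, by norm_num, by norm_num, by norm_num,
    fun L Δ ε hL hΔ hε hεLΔ => ?_⟩
  set R : ℝ := L * Δ / ε with hR
  have hR1 : 12288 < R := by
    rw [hR, lt_div_iff₀ hε]
    linarith
  obtain ⟨T, hT⟩ : ∃ T, ⌊R / 3072⌋₊ = T + 1 :=
    Nat.exists_eq_succ_of_ne_zero (Nat.floor_pos.2 (by linarith)).ne'
  have hTle : (T : ℝ) + 1 ≤ R / 3072 := by
    have := Nat.floor_le (show 0 ≤ R / 3072 by linarith)
    rw [hT] at this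
    exact_mod_cast this
  have hTge : R / 3072 < (T : ℝ) + 1 + 1 := by
    have := Nat.lt_floor_add_one (R / 3072)
    rw [hT] at this
    exact_mod_cast this
  have hT1 : 1 ≤ T := by
    have : (1 : ℝ) ≤ T := by linarith
    exact_mod_cast this
  have hK : 2 * ⌊1 / 12288 * R⌋₊ ≤ T := by
    have h := Nat.floor_le (show 0 ≤ 1 / 12288 * R by linarith)
    have : (2 : ℝ) * (⌊1 / 12288 * R⌋₊ : ℝ) ≤ T := by linarith
    exact_mod_cast this
  refine ⟨T, fun d hd n v _ σ A hA => ?_⟩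
  obtain ⟨f, f', hf, hlip, hmin, hlarge, hchain⟩ :=
    TimeOracle.exists_hard_function (d := d) (L := L) (Δ := Δ) hL hε hT1 hd (by
      rw [hR, le_div_iff₀ (by norm_num), le_div_iff₀ hε] at hTle
      linarith)
  have hgrad : ∀ x, gradient f x = f' x := fun x => (hf x).gradient
  set r : ℝ := σ ^ 2 / ε with hr
  have hr0 : 0 ≤ r := by positivity
  -- Solves `64 ε (1 - p) / p = σ²`, so the variance budget is met exactly; for `σ = 0` there is no
  -- noise.
  set p : ℝ := 64 / (64 + r) with hp
  have hp0 : 0 < p := by positivity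
  have hp1 : p ≤ 1 := by
    rw [hp, div_le_one (by positivity)]
    linarith
  have hprob := TimeOracle.isProbabilityMeasure_coin hp0.le hp1
  refine ⟨f, ⟨fun x => (hf x).differentiableAt, fun x y => ?_⟩, hmin, Bool, inferInstance,
    TimeOracle.coin p, hprob, TimeOracle.noisy f' p, ?_,
    TimeOracle.measurable_bestGradSq v (TimeOracle.noisy f' p) A f _, ?_⟩
  · rw [hgrad, hgrad]
    exact hlip x y
  · refine TimeOracle.isStochasticGradient_noisy hf hp0 hp1 (le_of_eq ?_) (by positivity) hchain
    rw [hp, hr]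
    field_simp
    ring
  · refine TimeOracle.lt_lintegral_bestGradSq hA
      (TimeOracle.revealsNext_noisy p fun x ℓ hx => (hchain x ℓ hx).1) hε hp0.le (by positivity)
      ?_ hT1 hK fun x hx => ?_
    · have hmax : max (⌈r⌉₊ : ℝ) 1 ≤ r + 1 :=
        max_le (Nat.ceil_lt_add_one hr0).le (by linarith)
      rw [hp, div_mul_eq_mul_div, div_le_iff₀ (by positivity)]
      linarith
    · rw [hgrad]
      exact hlarge x hx
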